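/- **Setting.** A (possibly infinite) random collection of children with real displacements is encoded by a point process $\aleph$ on $\mathbb R$, written as a finite or countable sum of Dirac masses at the displacements. Let $(V(u),\,u\in\mathbb T)$ be the branching random walk on $\mathbb R$ with reproduction law $\aleph$: the root $\varnothing$ sits at $V(\varnothing)=0$; independently for all particles, each particle $u$ gives birth to children whose displacements from $V(u)$ form a copy of $\aleph$; $\mathbb T$ is the resulting Ulam–Harris family tree. Let $\mu(dx)=\mathbb E[\aleph(dx)]$ be the intensity measure and assume $\mu(\mathbb R)>1$. Let $\mathcal S$ be the event that every generation is non-empty and $\mathbb P^*=\mathbb P(\,\cdot\mid\mathcal S)$. A ray $\xi=(\xi_0,\xi_1,\dots)$ is a path from the root $\xi_0=\varnothing$, with $\xi_{n+1}$ a child of $\xi_n$, that is either infinite or ends at a leaf of $\mathbb T$; $\partial\mathbb T$ is the set of all rays, and sums over $n$ along a finite ray run over its vertices only. Put $\varphi(t)=\log\int_{\mathbb R}e^{-tx}\mu(dx)\in[-\infty,\infty]$. The integral $\int_{\mathbb R} xe^{-tx}\mu(dx)$ is called well-defined if at least one of $\int_{(-\infty,0)}|x|e^{-tx}\mu(dx)$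 and $\int_{(0,\infty)}xe^{-tx}\mu(dx)$ is finite; its value then lies in $[-\infty,\infty]$. **(H1)** There is $t>0$ with $\varphi(t)=0$ and, with $t^*$ the minimal such $t$, the integral $\int_{\mathbb R} xe^{-t^*x}\mu(dx)$ is well-defined and nonzero. **(H2)** There is $t^*>0$ with $\varphi(t^*)=0$, and $\varphi(t)\in[0,\infty]$ for all $t>0$; the integral $\int_{\mathbb R} xe^{-t^*x}\mu(dx)$ is well-defined and equal to $0$, and $\int_{\mathbb R} x^2e^{-t^*x}\mu(dx)\in(0,\infty)$. **Theorem 1.1.** Let $$M:=\sup_{\xi\in\partial\mathbb T}\sum_{n\ge 0}e^{-V(\xi_n)},\qquad \Xi_b:=\sup_{\xi\in\partial\mathbb T}\sum_{n\ge 0}(1+|V(\xi_n)|)^{-b}.$$ Under (H1) or (H2), $M<\infty$ $\mathbb P^*$-almost surely. Moreover, under (H1), $\mathbb P^*$-almost surely $\Xi_b<\infty$ for all real $b>2$; and under (H2), $\mathbb P^*$-almost surely $\Xi_b<\infty$ for all real $b>3$. -/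

import Mathlib

open MeasureTheory ProbabilityTheory
open scoped ENNReal

noncomputable section

namespace BRW

/-- The offspring of one particle: the number of children (possibly infinite) and the sequence of
their displacements from the parent. If the number is `k`, the children are numbered by the
`i : ℕ` with `i < k`; the displacements with index `i ≥ k` play no role. -/
abbrev Offspring : Type := ℕ∞ × (ℕ → ℝ)

/-- The point process `∑ δ_{x_i}` formed by the children's displacements. -/
def pointProcess (l : Offspring) : Measure ℝ :=
  Measure.sum fun i : ℕ => if (i : ℕ∞) < l.1 then Measure.dirac (l.2 i) else 0

theorem measurable_pointProcess : Measurable pointProcess := by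
  refine Measure.measurable_of_measurable_coe _ fun s hs => ?_
  simp only [pointProcess, Measure.sum_apply _ hs]
  refine Measurable.tsum fun i => ?_
  refine (Measure.measurable_coe hs).comp (Measurable.ite ?_ ?_ measurable_const)
  · exact measurable_fst (MeasurableSet.of_discrete (s := {k : ℕ∞ | (i : ℕ∞) < k}))
  · exact Measure.measurable_dirac.comp ((measurable_pi_apply i).comp measurable_snd)

/-- Vertices in Ulam–Harris coding. The root is `[]` and the `i`-th child of `u` is `i :: u`
(most recent birth first), so that the generation of `u` is `u.length`. -/
abbrev Vertex : Type := List ℕ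

section Deterministic

/- Here `d u` is the offspring of the vertex `u`. -/

/-- The vertex `u` is present in the family tree. -/
def InTree (d : Vertex → Offspring) : Vertex → Prop
  | [] => True
  | i :: u => InTree d u ∧ (i : ℕ∞) < (d u).1

/-- The position `V(u)`: the root sits at `0`, and a child sits at its parent's position plus its
displacement. -/
def position (d : Vertex → Offspring) : Vertex → ℝ
  | [] => 0
  | i :: u => position d u + (d u).2 i

/-- Non-extinction: every generation is non-empty. -/
def Survives (d : Vertex → Offspring) : Prop :=
  ∀ n : ℕ, ∃ u : Vertex, u.length = n ∧ InTree d u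

/-- A ray of the tree: a path `ξ_0 = root, ξ_1, ξ_2, …` of successive children that is either
infinite (`length = ⊤`) or ends at a leaf `ξ_n` (`length = n`). The values `vertex n` with
`n > length` play no role. -/
structure Ray (d : Vertex → Offspring) where
  length : ℕ∞
  vertex : ℕ → Vertex
  vertex_zero : vertex 0 = []
  vertex_succ : ∀ n : ℕ, ((n + 1 : ℕ) : ℕ∞) ≤ length → ∃ i : ℕ, vertex (n + 1) = i :: vertex n
  mem_tree : ∀ n : ℕ, (n : ℕ∞) ≤ length → InTree d (vertex n)
  end_leaf : ∀ n : ℕ, length = (n : ℕ∞) → ∀ i : ℕ, ¬ InTree d (i :: vertex n)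

open Classical in
/-- The sum `∑_n g(V(ξ_n))` along a ray, over all the vertices of the ray. -/
def raySum (d : Vertex → Offspring) (g : ℝ → ℝ≥0∞) (ξ : Ray d) : ℝ≥0∞ :=
  ∑' n : ℕ, if (n : ℕ∞) ≤ ξ.length then g (position d (ξ.vertex n)) else 0

/-- `M = sup_ξ ∑_n e^{-V(ξ_n)}`, with values in `[0, ∞]`. -/
def M (d : Vertex → Offspring) : ℝ≥0∞ :=
  ⨆ ξ : Ray d, raySum d (fun x => ENNReal.ofReal (Real.exp (-x))) ξ

/-- `Ξ_b = sup_ξ ∑_n (1 + |V(ξ_n)|)^{-b}`, with values in `[0, ∞]`. -/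
def Xi (b : ℝ) (d : Vertex → Offspring) : ℝ≥0∞ :=
  ⨆ ξ : Ray d, raySum d (fun x => ENNReal.ofReal ((1 + |x|) ^ (-b))) ξ

end Deterministic

section Assumptions

/-- `φ(t) = log ∫ e^{-tx} μ(dx)`, with values in `[-∞, ∞]`. -/
def phi (μ : Measure ℝ) (t : ℝ) : EReal :=
  ENNReal.log (∫⁻ x, ENNReal.ofReal (Real.exp (-t * x)) ∂μ)

/-- `∫_{(0,∞)} x e^{-tx} μ(dx)`. -/
def posMoment (μ : Measure ℝ) (t : ℝ) : ℝ≥0∞ :=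
  ∫⁻ x in Set.Ioi 0, ENNReal.ofReal (x * Real.exp (-t * x)) ∂μ

/-- `∫_{(-∞,0)} |x| e^{-tx} μ(dx)`. -/
def negMoment (μ : Measure ℝ) (t : ℝ) : ℝ≥0∞ :=
  ∫⁻ x in Set.Iio 0, ENNReal.ofReal (|x| * Real.exp (-t * x)) ∂μ

/-- The integral `∫ x e^{-tx} μ(dx)` is well-defined (possibly infinite). -/
def TiltedMeanWellDefined (μ : Measure ℝ) (t : ℝ) : Prop :=
  negMoment μ t < ∞ ∨ posMoment μ t < ∞

/-- The value in `[-∞, ∞]` of `∫ x e^{-tx} μ(dx)`, meaningful when it is well-defined. -/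
def tiltedMean (μ : Measure ℝ) (t : ℝ) : EReal :=
  (posMoment μ t : EReal) - (negMoment μ t : EReal)

/-- There is a least `t > 0` with `φ(t) = 0`, and there `∫ x e^{-tx} μ(dx)` is well-defined and
non-zero. -/
def H1 (μ : Measure ℝ) : Prop :=
  ∃ t : ℝ, IsLeast {s : ℝ | 0 < s ∧ phi μ s = 0} t ∧ TiltedMeanWellDefined μ t ∧ tiltedMean μ t ≠ 0

/-- The boundary case. -/
def H2 (μ : Measure ℝ) : Prop :=
  ∃ t : ℝ, 0 < t ∧ phi μ t = 0 ∧ (∀ s : ℝ, 0 < s → 0 ≤ phi μ s) ∧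
    TiltedMeanWellDefined μ t ∧ tiltedMean μ t = 0 ∧
    0 < ∫⁻ x, ENNReal.ofReal (x ^ 2 * Real.exp (-t * x)) ∂μ ∧
    ∫⁻ x, ENNReal.ofReal (x ^ 2 * Real.exp (-t * x)) ∂μ < ∞

end Assumptions

section Random

variable {Ω : Type*} [MeasurableSpace Ω]

/-- `D` drives a branching random walk: the offspring `D u` of the potential vertices `u` are
independent and identically distributed random variables. The walk itself is
`V(u) = position (fun u => D u ω) u` on the tree of those `u` with `InTree (fun u => D u ω) u`. -/
structure IsBranchingRandomWalk (P : Measure Ω) (D : Vertex → Ω → Offspring) : Prop where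
  measurable : ∀ u, Measurable (D u)
  indep : iIndepFun D P
  identDistrib : ∀ u, IdentDistrib (D u) (D []) P P

/-- The intensity `μ = E[ℵ]` of the reproduction point process `ℵ`, the first generation. -/
def intensity (P : Measure Ω) (D : Vertex → Ω → Offspring) : Measure ℝ :=
  P.bind fun ω => pointProcess (D [] ω)

theorem intensity_apply {P : Measure Ω} {D : Vertex → Ω → Offspring} (hD : Measurable (D []))
    {B : Set ℝ} (hB : MeasurableSet B) :
    intensity P D B = ∫⁻ ω, pointProcess (D [] ω) B ∂P :=
  Measure.bind_apply hB (measurable_pointProcess.comp hD).aemeasurable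

/-- `P* = P( · | non-extinction)`. -/
def survivalMeasure (P : Measure Ω) (D : Vertex → Ω → Offspring) : Measure Ω :=
  ProbabilityTheory.cond P {ω | Survives fun u => D u ω}

end Random

end BRW

end

noncomputable section

namespace BRW

/-! Since φ(t) = 0, the tilt ν = e^{-tx} μ(dx) is a probability measure. By the many-to-one
principle, e^{-tV}-weighted sums over the tree are expectations for the random walk with step law ν.
Only an inequality is needed: a function superharmonic for the walk bounds the expected weighted
total over the tree (`lintegral_tsum_mass_le`).

The constant function, with killing below -K, shows that the tree goes below -K with probability at
most e^{-tK}, so positions are almost surely bounded below (`ae_bddBelow`).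

Let the walk killed below -K spend expected time at most G_k = C(1+|k|)^p in B_k = [kδ,(k+1)δ). Here
p = 0 if the mean is nonzero, by transience (`greenBound_of_mean_ne_zero`), and p = 1 if the walk is
centered with finite positive variance (`greenBound_of_mean_zero`). The number of visits to B_k then
has an exponential moment at scale G_k: weighting a vertex u in B_k by e^{-tV(u)} (1 +
1/(4G_k))^{visits} gives expected total at most 4G_k (`lintegral_visits_le`). After a summable
weighting over k these totals are almost surely finite together, hence every single term is bounded.
As V is at most linear in |k| on B_k, taking logarithms bounds the visits of every branch to B_k by
O((1+|k|)^{p+1}) (`ae_visits_le`).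

Along any ray the sum in Ξ_b is therefore at most a constant times ∑ (1+|k|)^{p+1-b}, finite for b >
p+2 (`Xi_lt_top`). Above the lower bound -K, e^{-x} is dominated by a multiple of (1+|x|)^{-4}, so M
is controlled by Ξ_4 (`M_lt_top`). -/

/-- The exponentially tilted measure `e^{-tx} μ(dx)`. -/
def tilt (t : ℝ) (μ : Measure ℝ) : Measure ℝ :=
  μ.withDensity fun x => ENNReal.ofReal (Real.exp (-t * x))

theorem lintegral_tilt (t : ℝ) (μ : Measure ℝ) {F : ℝ → ℝ≥0∞} (hF : Measurable F) :
    ∫⁻ x, F x ∂(tilt t μ) = ∫⁻ x, ENNReal.ofReal (Real.exp (-t * x)) * F x ∂μ := by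
  rw [tilt, lintegral_withDensity_eq_lintegral_mul _ (by fun_prop) hF]
  rfl

theorem lintegral_pointProcess (l : Offspring) {F : ℝ → ℝ≥0∞} (hF : Measurable F) :
    ∫⁻ x, F x ∂(pointProcess l) = ∑' i : ℕ, if (i : ℕ∞) < l.1 then F (l.2 i) else 0 := by
  rw [pointProcess, lintegral_sum_measure]
  refine tsum_congr fun i => ?_
  split_ifs
  · rw [lintegral_dirac' _ hF]
  · simp

/-! ### Many-to-one inequalities on the tree -/

section Tree

variable {Ω : Type*} [MeasurableSpace Ω]

theorem lintegral_intensity {P : Measure Ω} {D : Vertex → Ω → Offspring} (hD : Measurable (D []))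
    {F : ℝ → ℝ≥0∞} (hF : Measurable F) :
    ∫⁻ x, F x ∂(intensity P D)
      = ∫⁻ ω, ∑' i : ℕ, (if (i : ℕ∞) < (D [] ω).1 then F ((D [] ω).2 i) else 0) ∂P := by
  have hm : Measurable fun ω => pointProcess (D [] ω) := measurable_pointProcess.comp hD
  rw [intensity, Measure.lintegral_bind hm.aemeasurable hF.aemeasurable]
  exact lintegral_congr fun ω => lintegral_pointProcess _ hF

open Classical in
/-- `e^{-tV(u)} ∏ r(V(v))` over the strict ancestors `v` of `u`, if `u` is in the tree; `0` if
not. -/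
def mass (t : ℝ) (r : ℝ → ℝ≥0∞) (d : Vertex → Offspring) : Vertex → ℝ≥0∞
  | [] => 1
  | i :: u => mass t r d u * r (position d u) *
      if (i : ℕ∞) < (d u).1 then ENNReal.ofReal (Real.exp (-t * (d u).2 i)) else 0

theorem measurable_position (u : Vertex) :
    Measurable fun d : Vertex → Offspring => position d u := by
  induction u with
  | nil => exact measurable_const
  | cons i u ih =>
    refine ih.add ?_
    exact (measurable_pi_apply i).comp (measurable_snd.comp (measurable_pi_apply u))

theorem measurableSet_fst_lt (i : ℕ) : MeasurableSet {l : Offspring | (i : ℕ∞) < l.1} :=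
  measurable_fst (MeasurableSet.of_discrete (s := {k : ℕ∞ | (i : ℕ∞) < k}))

theorem measurable_mass (t : ℝ) {r : ℝ → ℝ≥0∞} (hr : Measurable r) (u : Vertex) :
    Measurable fun d : Vertex → Offspring => mass t r d u := by
  induction u with
  | nil => exact measurable_const
  | cons i u ih =>
    refine (ih.mul (hr.comp (measurable_position u))).mul ?_
    have hu : Measurable fun d : Vertex → Offspring => d u := measurable_pi_apply u
    refine Measurable.ite (hu (measurableSet_fst_lt i)) ?_ measurable_const
    have : Measurable fun d : Vertex → Offspring => (d u).2 i :=
      (measurable_pi_apply i).comp (measurable_snd.comp (measurable_pi_apply u))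
    fun_prop

/-- Only strict ancestors are consulted; excluding u itself is what yields independence from the
offspring of u. -/
theorem position_congr {d d' : Vertex → Offspring} {u : Vertex}
    (h : ∀ v, v <:+ u → v ≠ u → d v = d' v) : position d u = position d' u := by
  induction u with
  | nil => rfl
  | cons i u ih =>
    have hu : d u = d' u := h u (List.suffix_cons i u) (by simp)
    rw [position, position, hu, ih]
    intro v hv hne
    refine h v (hv.trans (List.suffix_cons i u)) fun e => ?_
    have := hv.length_le
    simp [e] at this

theorem mass_congr (t : ℝ) (r : ℝ → ℝ≥0∞) {d d' : Vertex → Offspring} {u : Vertex}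
    (h : ∀ v, v <:+ u → v ≠ u → d v = d' v) : mass t r d u = mass t r d' u := by
  induction u with
  | nil => rfl
  | cons i u ih =>
    have hu : d u = d' u := h u (List.suffix_cons i u) (by simp)
    have h' : ∀ v, v <:+ u → v ≠ u → d v = d' v := by
      intro v hv hne
      refine h v (hv.trans (List.suffix_cons i u)) fun e => ?_
      have := hv.length_le
      simp [e] at this
    rw [mass, mass, hu, ih h', position_congr h']

/-- The mass and the position of `u` are independent of the offspring of `u`. -/
theorem indepFun_mass_position {P : Measure Ω} {D : Vertex → Ω → Offspring}
    (hD : IsBranchingRandomWalk P D) (t : ℝ) {r : ℝ → ℝ≥0∞} (hr : Measurable r) (u : Vertex) :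
    IndepFun (fun ω => (mass t r (fun v => D v ω) u, position (fun v => D v ω) u)) (D u) P := by
  classical
  let S : Finset Vertex := u.tails.toFinset.erase u
  have hS : Disjoint S {u} := by simp [S]
  have hind := hD.indep.indepFun_finset S {u} hS hD.measurable
  -- Extends data on the strict ancestors to all vertices; the childless default is never read.
  let e : (S → Offspring) → (Vertex → Offspring) :=
    fun x v => if h : v ∈ S then x ⟨v, h⟩ else (0, fun _ => 0)
  have he : Measurable e := by
    refine measurable_pi_lambda _ fun v => ?_
    by_cases h : v ∈ S
    · simpa [e, h] using measurable_pi_apply _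
    · simp [e, h]
  have hagree : ∀ ω v, v <:+ u → v ≠ u → e (fun i : S => D i ω) v = D v ω := by
    intro ω v hv hne
    have : v ∈ S := by simp [S, hne, hv]
    simp [e, this]
  have hval : Measurable fun x : ({u} : Finset Vertex) → Offspring =>
      x ⟨u, Finset.mem_singleton_self u⟩ := measurable_pi_apply _
  have := hind.comp
    (φ := fun x => (mass t r (e x) u, position (e x) u))
    (ψ := fun x : ({u} : Finset Vertex) → Offspring => x ⟨u, Finset.mem_singleton_self u⟩)
    (((measurable_mass t hr u).comp he).prodMk ((measurable_position u).comp he))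
    hval
  convert this using 1
  swap; · rfl
  funext ω
  simp only [Function.comp]
  rw [mass_congr t r (fun v hv hne => hagree ω v hv hne), position_congr (fun v hv hne => hagree ω v hv hne)]

theorem measurable_apply {P : Measure Ω} {D : Vertex → Ω → Offspring}
    (hD : IsBranchingRandomWalk P D) : Measurable fun ω v => D v ω :=
  measurable_pi_lambda _ hD.measurable

/-- One step of the many-to-one formula. -/
theorem lintegral_children {P : Measure Ω} [IsProbabilityMeasure P] {D : Vertex → Ω → Offspring}
    (hD : IsBranchingRandomWalk P D) (t : ℝ) {r h : ℝ → ℝ≥0∞} (hr : Measurable r)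
    (hh : Measurable h) (u : Vertex) :
    ∑' i : ℕ, ∫⁻ ω, mass t r (fun v => D v ω) (i :: u) * h (position (fun v => D v ω) (i :: u)) ∂P
      = ∫⁻ ω, mass t r (fun v => D v ω) u * (r (position (fun v => D v ω) u) *
          ∫⁻ z, h (position (fun v => D v ω) u + z) ∂(tilt t (intensity P D))) ∂P := by
  classical
  have hm := measurable_apply hD
  have hmeas : Measurable fun p : (ℝ≥0∞ × ℝ) × Offspring => p.1.1 * (r p.1.2 *
      ∑' i : ℕ, if (i : ℕ∞) < p.2.1 then
        ENNReal.ofReal (Real.exp (-t * p.2.2 i)) * h (p.1.2 + p.2.2 i) else 0) := by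
    refine (measurable_fst.comp measurable_fst).mul ((hr.comp (measurable_snd.comp measurable_fst)).mul
      (Measurable.tsum fun i => ?_))
    have hi : Measurable fun p : (ℝ≥0∞ × ℝ) × Offspring => p.2.2 i :=
      (measurable_pi_apply i).comp (measurable_snd.comp measurable_snd)
    refine Measurable.ite (measurable_snd (measurableSet_fst_lt i)) ?_ measurable_const
    have : Measurable fun p : (ℝ≥0∞ × ℝ) × Offspring => p.1.2 :=
      measurable_snd.comp measurable_fst
    fun_prop
  rw [← lintegral_tsum]
  swap
  · intro i
    exact (((measurable_mass t hr (i :: u)).comp hm).mul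
      (hh.comp ((measurable_position (i :: u)).comp hm))).aemeasurable
  have hpair : Measurable fun ω => (mass t r (fun v => D v ω) u, position (fun v => D v ω) u) :=
    ((measurable_mass t hr u).comp hm).prodMk ((measurable_position u).comp hm)
  -- The joint law is a product, so the offspring of u can be integrated out with its mass and
  -- position fixed; this produces the tilted intensity.
  have hlaw := (indepFun_iff_map_prod_eq_prod_map_map hpair.aemeasurable
    (hD.measurable u).aemeasurable).1 (indepFun_mass_position hD t hr u)
  have hL : ∀ ω, (∑' i : ℕ, mass t r (fun v => D v ω) (i :: u) *
      h (position (fun v => D v ω) (i :: u))) =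
      (fun p : (ℝ≥0∞ × ℝ) × Offspring => p.1.1 * (r p.1.2 *
      ∑' i : ℕ, if (i : ℕ∞) < p.2.1 then
        ENNReal.ofReal (Real.exp (-t * p.2.2 i)) * h (p.1.2 + p.2.2 i) else 0))
      ((mass t r (fun v => D v ω) u, position (fun v => D v ω) u), D u ω) := by
    intro ω
    simp only [← ENNReal.tsum_mul_left]
    refine tsum_congr fun i => ?_
    rw [mass, position]
    split_ifs
    · ring
    · simp
  rw [lintegral_congr hL, ← lintegral_map hmeas (hpair.prodMk (hD.measurable u)), hlaw,
    lintegral_prod _ hmeas.aemeasurable, lintegral_map hmeas.lintegral_prod_right' hpair]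
  refine lintegral_congr fun ω => ?_
  have hsec : Measurable fun l : Offspring => ∑' i : ℕ, if (i : ℕ∞) < l.1 then
        ENNReal.ofReal (Real.exp (-t * l.2 i)) * h (position (fun v => D v ω) u + l.2 i) else 0 := by
    refine Measurable.tsum fun i => Measurable.ite (measurableSet_fst_lt i) ?_ measurable_const
    have hi : Measurable fun p : Offspring => p.2 i :=
      (measurable_pi_apply i).comp measurable_snd
    fun_prop
  simp only
  rw [lintegral_const_mul _ (hsec.const_mul _), lintegral_const_mul _ hsec, (hD.identDistrib u).map_eq, lintegral_map hsec (hD.measurable []),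
    lintegral_tilt _ _ (by fun_prop), lintegral_intensity (hD.measurable []) (by fun_prop)]

theorem tsum_length_succ (n : ℕ) (F : Vertex → ℝ≥0∞) :
    ∑' u : Vertex, (if u.length = n + 1 then F u else 0)
      = ∑' u : Vertex, if u.length = n then ∑' i : ℕ, F (i :: u) else 0 := by
  have hinj : Function.Injective fun p : Vertex × ℕ => (p.2 :: p.1 : Vertex) := by
    rintro ⟨u, i⟩ ⟨v, j⟩ h
    simp at h
    simp [h]
  rw [← hinj.tsum_eq (f := fun u : Vertex => if u.length = n + 1 then F u else 0),
    ENNReal.tsum_prod (f := fun (u : Vertex) (i : ℕ) =>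
      if (i :: u : Vertex).length = n + 1 then F (i :: u) else 0)]
  · refine tsum_congr fun u => ?_
    by_cases h : u.length = n <;> simp [h]
  · intro u hu
    cases u with
    | nil => simp at hu
    | cons i u => exact ⟨(u, i), rfl⟩

theorem tsum_eq_tsum_length (F : Vertex → ℝ≥0∞) :
    ∑' u : Vertex, F u = ∑' n : ℕ, ∑' u : Vertex, if u.length = n then F u else 0 := by
  rw [ENNReal.tsum_comm]
  refine tsum_congr fun u => ?_
  simp

/-- If `A` is a supermartingale along the tree with drift at least `B`, the total of `B` is at most
the initial value of `A`. -/
theorem tsum_le_of_children_le {A B : Vertex → ℝ≥0∞} (h : ∀ u, (∑' i : ℕ, A (i :: u)) + B u ≤ A u) :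
    ∑' u, B u ≤ A [] := by
  rw [tsum_eq_tsum_length, ENNReal.tsum_eq_iSup_nat]
  -- The induction keeps the total of A over generation n next to the total of B over earlier
  -- generations: this sum does not increase with n.
  refine iSup_le fun n => le_trans le_self_add
    (b := _ + ∑' u : Vertex, if u.length = n then A u else 0) ?_
  induction n with
  | zero =>
    simp only [Finset.range_zero, Finset.sum_empty, zero_add]
    rw [tsum_eq_single []]
    · simp
    · intro u hu
      simp [hu]
  | succ n ih =>
    refine le_trans ?_ ih
    rw [Finset.sum_range_succ, add_assoc, tsum_length_succ, ← ENNReal.tsum_add]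
    gcongr with u
    split_ifs
    · rw [add_comm]; exact h u
    · simp

/-- If `r · Th + f ≤ h`, where `T` is the transition operator of the tilted random walk, then the
expected total of `mass · f` over the tree is at most `h 0`. -/
theorem lintegral_tsum_mass_le {P : Measure Ω} [IsProbabilityMeasure P]
    {D : Vertex → Ω → Offspring} (hD : IsBranchingRandomWalk P D) (t : ℝ) {r f h : ℝ → ℝ≥0∞}
    (hr : Measurable r) (hf : Measurable f) (hh : Measurable h)
    (hle : ∀ y, r y * ∫⁻ z, h (y + z) ∂(tilt t (intensity P D)) + f y ≤ h y) :
    ∫⁻ ω, ∑' u, mass t r (fun v => D v ω) u * f (position (fun v => D v ω) u) ∂P ≤ h 0 := by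
  have hm := measurable_apply hD
  have hmf : ∀ u, Measurable fun ω =>
      mass t r (fun v => D v ω) u * f (position (fun v => D v ω) u) := fun u =>
    ((measurable_mass t hr u).comp hm).mul (hf.comp ((measurable_position u).comp hm))
  rw [lintegral_tsum fun u => (hmf u).aemeasurable]
  have := tsum_le_of_children_le
    (A := fun u => ∫⁻ ω, mass t r (fun v => D v ω) u * h (position (fun v => D v ω) u) ∂P)
    (B := fun u => ∫⁻ ω, mass t r (fun v => D v ω) u * f (position (fun v => D v ω) u) ∂P) ?_
  · simpa [mass, position] using this
  · intro u
    rw [lintegral_children hD t hr hh, ← lintegral_add_right _ (hmf u)]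
    refine lintegral_mono fun ω => ?_
    rw [← mul_add]
    gcongr
    exact hle _

end Tree

/-! ### Transience of random walks with nonzero mean -/

section Transience

open Filter Topology

/-- A random walk whose step has a well-defined positive mean, possibly infinite, drifts
to `+∞`. -/
theorem tendsto_sum_atTop {Ω : Type*} [MeasurableSpace Ω] {Q : Measure Ω} [IsProbabilityMeasure Q]
    {X : ℕ → Ω → ℝ} (hX : ∀ i, Measurable (X i)) (hind : iIndepFun X Q)
    (hid : ∀ i, IdentDistrib (X i) (X 0) Q Q)
    (h : ∫⁻ ω, ENNReal.ofReal (-X 0 ω) ∂Q < ∫⁻ ω, ENNReal.ofReal (X 0 ω) ∂Q) :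
    ∀ᵐ ω ∂Q, Tendsto (fun n => ∑ i ∈ Finset.range n, X i ω) atTop atTop := by
  -- Truncating the steps from above at a large A keeps the mean positive and makes it finite. The
  -- strong law then applies to the truncated walk, which lies below the original one.
  obtain ⟨A, hA⟩ : ∃ A : ℕ, ∫⁻ ω, ENNReal.ofReal (-X 0 ω) ∂Q
      < ∫⁻ ω, ENNReal.ofReal (min (X 0 ω) A) ∂Q := by
    rw [← lt_iSup_iff, ← lintegral_iSup]
    · refine h.trans_le (lintegral_mono fun ω => ?_)
      obtain ⟨A, hA⟩ := exists_nat_ge (X 0 ω)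
      refine le_iSup_of_le A ?_
      rw [min_eq_left hA]
    · intro A
      exact ((hX 0).min measurable_const).ennreal_ofReal
    · intro A B hAB ω
      refine ENNReal.ofReal_le_ofReal (min_le_min_left _ ?_)
      exact_mod_cast hAB
  have hmin : Measurable fun x : ℝ => min x (A : ℝ) := measurable_id.min measurable_const
  have hneg : ∀ ω, ENNReal.ofReal (-min (X 0 ω) A) = ENNReal.ofReal (-X 0 ω) := by
    intro ω
    rcases le_total (X 0 ω) A with hle | hle
    · rw [min_eq_left hle]
    · have hA0 : (0 : ℝ) ≤ A := Nat.cast_nonneg A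
      rw [min_eq_right hle, ENNReal.ofReal_of_nonpos (by linarith),
        ENNReal.ofReal_of_nonpos (by linarith)]
  have hnegfin : ∫⁻ ω, ENNReal.ofReal (-min (X 0 ω) A) ∂Q ≠ ∞ := by
    simp only [hneg]; exact h.ne_top
  have hposfin : ∫⁻ ω, ENNReal.ofReal (min (X 0 ω) A) ∂Q ≠ ∞ := by
    refine ne_top_of_le_ne_top (b := ∫⁻ _, ENNReal.ofReal A ∂Q) (by simp) ?_
    exact lintegral_mono fun ω => ENNReal.ofReal_le_ofReal (min_le_right _ _)
  have hint : Integrable (fun ω => min (X 0 ω) (A : ℝ)) Q := by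
    refine ⟨(hmin.comp (hX 0)).aestronglyMeasurable, ?_⟩
    have habs : ∀ x : ℝ, ‖x‖ₑ ≤ ENNReal.ofReal x + ENNReal.ofReal (-x) := by
      intro x
      rw [Real.enorm_eq_ofReal_abs]
      rcases abs_cases x with ⟨e, _⟩ | ⟨e, _⟩ <;> rw [e]
      · exact le_self_add
      · exact le_add_self
    refine lt_of_le_of_lt (lintegral_mono fun ω => habs _) ?_
    have hm : Measurable fun ω => ENNReal.ofReal (min (X 0 ω) (A : ℝ)) :=
      (hmin.comp (hX 0)).ennreal_ofReal
    rw [lintegral_add_left hm]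
    exact ENNReal.add_lt_top.2 ⟨hposfin.lt_top, hnegfin.lt_top⟩
  have hpos : 0 < ∫ ω, min (X 0 ω) (A : ℝ) ∂Q := by
    rw [integral_eq_lintegral_pos_part_sub_lintegral_neg_part hint, sub_pos]
    refine (ENNReal.toReal_lt_toReal hnegfin hposfin).2 ?_
    simpa only [hneg] using hA
  have hlaw := strong_law_ae_real (fun i ω => min (X i ω) (A : ℝ)) hint
    (fun i j hij => (hind.indepFun hij).comp hmin hmin) fun i => (hid i).comp hmin
  filter_upwards [hlaw] with ω hω
  have hdiv : Tendsto (fun n : ℕ => (n : ℝ) *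
      ((∑ i ∈ Finset.range n, min (X i ω) (A : ℝ)) / n)) atTop atTop :=
    tendsto_natCast_atTop_atTop.atTop_mul_pos hpos hω
  refine tendsto_atTop_mono' _ ?_ hdiv
  filter_upwards [eventually_gt_atTop 0] with n hn
  rw [mul_div_cancel₀ _ (by positivity)]
  exact Finset.sum_le_sum fun i _ => min_le_left _ _

/-- Prepending an independent coordinate to an i.i.d. sequence gives an i.i.d. sequence. -/
theorem map_cons_infinitePi (ν : Measure ℝ) [IsProbabilityMeasure ν] :
    (ν.prod (Measure.infinitePi fun _ : ℕ => ν)).map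
      (fun p (n : ℕ) => Nat.casesOn (motive := fun _ => ℝ) n p.1 p.2) = Measure.infinitePi fun _ : ℕ => ν := by
  have hm : Measurable fun (p : ℝ × (ℕ → ℝ)) (n : ℕ) =>
      Nat.casesOn (motive := fun _ => ℝ) n p.1 p.2 := by
    refine measurable_pi_lambda _ fun n => ?_
    cases n with
    | zero => exact measurable_fst
    | succ n => exact (measurable_pi_apply n).comp measurable_snd
  refine Measure.eq_infinitePi _ fun s t ht => ?_
  rw [Measure.map_apply hm (MeasurableSet.pi s.countable_toSet fun i _ => ht i)]
  let s' : Finset ℕ := s.preimage (· + 1) (by intro a _ b _ h; simpa using h)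
  have hmem : ∀ i, i ∈ s' ↔ i + 1 ∈ s := fun i => Finset.mem_preimage
  have hpre : (fun (p : ℝ × (ℕ → ℝ)) (n : ℕ) =>
      Nat.casesOn (motive := fun _ => ℝ) n p.1 p.2) ⁻¹' (s : Set ℕ).pi t =
      (if 0 ∈ s then t 0 else Set.univ) ×ˢ ((s' : Set ℕ).pi fun i => t (i + 1)) := by
    ext p
    simp only [Set.mem_preimage, Set.mem_pi, Set.mem_prod, Finset.mem_coe]
    constructor
    · intro h
      refine ⟨?_, fun i hi => h (i + 1) (by simpa [hmem] using hi)⟩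
      split_ifs with h0
      · exact h 0 h0
      · trivial
    · rintro ⟨h0, h1⟩ i hi
      cases i with
      | zero => simpa [hi] using h0
      | succ i => exact h1 i (by simpa [hmem] using hi)
  rw [hpre, Measure.prod_prod, Measure.infinitePi_pi _ fun i _ => ht (i + 1)]
  have hs' : ∏ i ∈ s', ν (t (i + 1)) = ∏ i ∈ s.erase 0, ν (t i) := by
    refine Finset.prod_bij (fun i _ => i + 1) ?_ ?_ ?_ ?_
    · intro i hi; simpa [hmem] using hi
    · intro a _ b _ h; simpa using h
    · intro b hb
      cases b with
      | zero => simp at hb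
      | succ b => exact ⟨b, by simpa [hmem] using hb, rfl⟩
    · intros; rfl
  rw [hs']
  split_ifs with h0
  · exact Finset.mul_prod_erase s (fun i => ν (t i)) h0
  · simp [Finset.erase_eq_of_notMem h0]

/-- The law of the sequence of steps of a random walk with step law `ν`. -/
abbrev stepLaw (ν : Measure ℝ) [IsProbabilityMeasure ν] : Measure (ℕ → ℝ) :=
  Measure.infinitePi fun _ : ℕ => ν

/-- A random walk whose step has a well-defined non-zero mean is transient. -/
theorem tendsto_abs_sum_atTop (ν : Measure ℝ) [IsProbabilityMeasure ν]
    (h : ∫⁻ x, ENNReal.ofReal (-x) ∂ν ≠ ∫⁻ x, ENNReal.ofReal x ∂ν) :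
    ∀ᵐ ω ∂(stepLaw ν), Tendsto (fun n => |∑ i ∈ Finset.range n, ω i|) atTop atTop := by
  have hlint : ∀ (i : ℕ) {F : ℝ → ℝ≥0∞}, Measurable F →
      ∫⁻ ω, F (ω i) ∂(stepLaw ν) = ∫⁻ x, F x ∂ν := fun i F hF =>
    (measurePreserving_eval_infinitePi (fun _ : ℕ => ν) i).lintegral_comp hF
  have hmap : ∀ {Y : ℝ → ℝ}, Measurable Y → ∀ i : ℕ,
      IdentDistrib (fun ω : ℕ → ℝ => Y (ω i)) (fun ω => Y (ω 0)) (stepLaw ν) (stepLaw ν) := by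
    intro Y hY i
    have he : ∀ j : ℕ, Measurable fun ω : ℕ → ℝ => ω j := measurable_pi_apply
    refine IdentDistrib.comp (f := fun ω : ℕ → ℝ => ω i) (g := fun ω : ℕ → ℝ => ω 0)
      ⟨(he i).aemeasurable, (he 0).aemeasurable, ?_⟩ hY
    rw [Measure.infinitePi_map_eval, Measure.infinitePi_map_eval]
  rcases lt_or_gt_of_ne h with h | h
  · have := tendsto_sum_atTop (Q := stepLaw ν) (X := fun i ω => ω i) (fun i => measurable_pi_apply i)
      (iIndepFun_infinitePi (X := fun _ x => x) fun _ => measurable_id)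
      (hmap measurable_id) (by
        rwa [hlint 0 (F := fun x => ENNReal.ofReal (-x)) (by fun_prop),
          hlint 0 (F := fun x => ENNReal.ofReal x) (by fun_prop)])
    filter_upwards [this] with ω hω using tendsto_abs_atTop_atTop.comp hω
  · have := tendsto_sum_atTop (Q := stepLaw ν) (X := fun i ω => -ω i)
      (fun i => (measurable_pi_apply i).neg)
      (iIndepFun_infinitePi (X := fun _ x => -x) fun _ => measurable_neg)
      (hmap measurable_neg) (by
        simp only [neg_neg]
        rwa [hlint 0 (F := fun x => ENNReal.ofReal (-x)) (by fun_prop),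
          hlint 0 (F := fun x => ENNReal.ofReal x) (by fun_prop)])
    filter_upwards [this] with ω hω
    refine (tendsto_abs_atTop_atTop.comp hω).congr fun n => ?_
    simp [Finset.sum_neg_distrib]

/-- The probability that the random walk started at `y` visits `B` at time `j` or later. -/
def hitAfter (ν : Measure ℝ) [IsProbabilityMeasure ν] (B : Set ℝ) (j : ℕ) (y : ℝ) : ℝ≥0∞ :=
  stepLaw ν {ω | ∃ n ≥ j, y + ∑ i ∈ Finset.range n, ω i ∈ B}

variable (ν : Measure ℝ) [IsProbabilityMeasure ν] {B : Set ℝ}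

theorem measurableSet_hit {α : Type*} [MeasurableSpace α] (hB : MeasurableSet B) (j : ℕ)
    {y : α → ℝ} {x : α → ℕ → ℝ} (hy : Measurable y) (hx : Measurable x) :
    MeasurableSet {a | ∃ n ≥ j, y a + ∑ i ∈ Finset.range n, x a i ∈ B} := by
  have : {a | ∃ n ≥ j, y a + ∑ i ∈ Finset.range n, x a i ∈ B}
      = ⋃ n, ⋃ (_ : n ≥ j), {a | y a + ∑ i ∈ Finset.range n, x a i ∈ B} := by
    ext; simp
  rw [this]
  refine MeasurableSet.iUnion fun n => MeasurableSet.iUnion fun _ => ?_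
  have : Measurable fun a => y a + ∑ i ∈ Finset.range n, x a i :=
    hy.add (Finset.measurable_sum _ fun i _ => (measurable_pi_apply i).comp hx)
  exact this hB

theorem measurable_hitAfter (hB : MeasurableSet B) (j : ℕ) : Measurable (hitAfter ν B j) :=
  measurable_measure_prodMk_left (measurableSet_hit hB j measurable_fst measurable_snd)

/-- Markov property at time 1: averaging over the first step delays the time window by one, so sums
over j telescope. -/
theorem lintegral_hitAfter (hB : MeasurableSet B) (j : ℕ) (y : ℝ) :
    ∫⁻ z, hitAfter ν B j (y + z) ∂ν = hitAfter ν B (j + 1) y := by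
  have hm : Measurable fun (p : ℝ × (ℕ → ℝ)) (n : ℕ) =>
      Nat.casesOn (motive := fun _ => ℝ) n p.1 p.2 := by
    refine measurable_pi_lambda _ fun n => ?_
    cases n with
    | zero => exact measurable_fst
    | succ n => exact (measurable_pi_apply n).comp measurable_snd
  have hmeas : MeasurableSet {p : ℝ × (ℕ → ℝ) |
      ∃ n ≥ j, y + p.1 + ∑ i ∈ Finset.range n, p.2 i ∈ B} :=
    measurableSet_hit hB j (measurable_const.add measurable_fst) measurable_snd
  have h1 := Measure.prod_apply (μ := ν) (ν := stepLaw ν) hmeas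
  have h2 := Measure.map_apply (μ := ν.prod (stepLaw ν)) hm (measurableSet_hit
    (y := fun _ => y) (x := fun ω : ℕ → ℝ => ω) hB (j + 1) measurable_const measurable_id)
  rw [map_cons_infinitePi] at h2
  refine h1.symm.trans (Eq.trans (congrArg _ ?_) h2.symm)
  ext p
  simp only [Set.mem_ofPred_eq, Set.mem_preimage]
  constructor
  · rintro ⟨n, hn, h⟩
    refine ⟨n + 1, by omega, ?_⟩
    rw [Finset.sum_range_succ']
    convert h using 1
    change y + (∑ i ∈ Finset.range n, p.2 i + p.1) = _
    ring
  · rintro ⟨n, hn, h⟩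
    obtain ⟨n, rfl⟩ : ∃ k, n = k + 1 := ⟨n - 1, by omega⟩
    refine ⟨n, by omega, ?_⟩
    rw [Finset.sum_range_succ'] at h
    convert h using 1
    change _ = y + (∑ i ∈ Finset.range n, p.2 i + p.1)
    ring

theorem hitAfter_anti {i j : ℕ} (hij : i ≤ j) (y : ℝ) : hitAfter ν B j y ≤ hitAfter ν B i y :=
  measure_mono fun _ ⟨n, hn, h⟩ => ⟨n, hij.trans hn, h⟩

theorem hitAfter_zero {y : ℝ} (hy : y ∈ B) : hitAfter ν B 0 y = 1 := by
  have : {ω : ℕ → ℝ | ∃ n ≥ 0, y + ∑ i ∈ Finset.range n, ω i ∈ B} = Set.univ :=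
    Set.eq_univ_of_forall fun ω => ⟨0, le_rfl, by simpa using hy⟩
  rw [hitAfter, this, measure_univ]

/-- A transient walk eventually stays away from its starting point with probability at
least `1/2`. -/
theorem exists_hitAfter_le
    (h : ∀ᵐ ω ∂(stepLaw ν), Tendsto (fun n => |∑ i ∈ Finset.range n, ω i|) atTop atTop) :
    ∃ m, hitAfter ν (Set.Icc (-1) 1) m 0 ≤ 1 / 2 := by
  have hlim : Tendsto (fun m => hitAfter ν (Set.Icc (-1) 1) m 0) atTop (𝓝 0) := by
    have := tendsto_measure_iInter_atTop (μ := stepLaw ν)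
      (s := fun m => {ω : ℕ → ℝ | ∃ n ≥ m, (0 : ℝ) + ∑ i ∈ Finset.range n, ω i ∈ Set.Icc (-1 : ℝ) 1})
      (fun m => (measurableSet_hit measurableSet_Icc m measurable_const
        measurable_id).nullMeasurableSet)
      (fun i j hij _ ⟨n, hn, h⟩ => ⟨n, hij.trans hn, h⟩) ⟨0, measure_ne_top _ _⟩
    convert this using 1
    · rfl
    refine congrArg _ (Eq.symm ?_)
    rw [measure_eq_zero_iff_ae_notMem]
    filter_upwards [h] with ω hω hmem
    obtain ⟨N, hN⟩ := eventually_atTop.1 (hω.eventually_gt_atTop 1)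
    obtain ⟨n, hn, hmem⟩ := Set.mem_iInter.1 hmem N
    rw [zero_add, Set.mem_Icc, ← abs_le] at hmem
    exact absurd (hN n hn) (not_lt.2 hmem)
  exact (hlim.eventually_le_const (by simp)).exists

end Transience

/-! ### Green bound in the transient case -/

/-- The tilted random walk killed below `-K` spends in the interval `[kδ, (k+1)δ)` an expected
time `O((1 + |k|) ^ p)`: there is a superharmonic function witnessing this. -/
def GreenBound (ν : Measure ℝ) (δ : ℝ) (p : ℕ) : Prop :=
  ∀ K : ℝ, ∃ C : ℝ, ∀ k : ℤ, ∃ g : ℝ → ℝ≥0∞, Measurable g ∧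
    (∀ y, g y ≤ ENNReal.ofReal (C * (1 + |(k : ℝ)|) ^ p)) ∧
    ∀ y, -K ≤ y → (Set.Ico (k * δ) ((k + 1) * δ)).indicator 1 y + ∫⁻ z, g (y + z) ∂ν ≤ g y

/-- Take g = 2 ∑_{j<m} `hitAfter` at j. One step of the walk lowers the sum by `hitAfter` at 0 minus
`hitAfter` at m. On B the former is 1 and the latter at most 1/2, since a return to an interval of
length 1 is a displacement in [-1,1]; the factor 2 turns the gap into a drop of 1. The same m serves
all k. -/
theorem greenBound_of_mean_ne_zero (ν : Measure ℝ) [IsProbabilityMeasure ν]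
    (h : ∫⁻ x, ENNReal.ofReal (-x) ∂ν ≠ ∫⁻ x, ENNReal.ofReal x ∂ν) : GreenBound ν 1 0 := by
  obtain ⟨m, hm⟩ := exists_hitAfter_le ν (tendsto_abs_sum_atTop ν h)
  intro K
  refine ⟨2 * m, fun k => ?_⟩
  set B := Set.Ico ((k : ℝ) * 1) ((k + 1) * 1) with hB
  have hBm : MeasurableSet B := measurableSet_Ico
  refine ⟨fun y => 2 * ∑ j ∈ Finset.range m, hitAfter ν B j y,
    (Finset.measurable_sum _ fun j _ => measurable_hitAfter ν hBm j).const_mul _, ?_, ?_⟩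
  · intro y
    rw [pow_zero, mul_one, ENNReal.ofReal_mul zero_le_two, ENNReal.ofReal_natCast,
      ENNReal.ofReal_ofNat]
    refine mul_le_mul_right ?_ 2
    refine (Finset.sum_le_card_nsmul _ _ 1 fun j _ => prob_le_one).trans ?_
    simp
  · intro y _
    rw [lintegral_const_mul, lintegral_finsetSum]
    rotate_left
    · exact fun j _ => (measurable_hitAfter ν hBm j).comp (measurable_const_add y)
    · exact Finset.measurable_sum _ fun j _ =>
        (measurable_hitAfter ν hBm j).comp (measurable_const_add y)
    simp only [lintegral_hitAfter ν hBm]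
    by_cases hy : y ∈ B
    · have hfar : hitAfter ν B m y ≤ 1 / 2 := by
        refine le_trans (measure_mono ?_) hm
        rintro ω ⟨n, hn, hmem⟩
        refine ⟨n, hn, ?_⟩
        simp only [hB, Set.mem_Ico, mul_one] at hy hmem
        simp only [Set.mem_Icc]
        constructor <;> linarith [hy.1, hy.2, hmem.1, hmem.2]
      have htel := (Finset.sum_range_succ' (fun j => hitAfter ν B j y) m).symm.trans
        (Finset.sum_range_succ (fun j => hitAfter ν B j y) m)
      rw [hitAfter_zero ν hy] at htel
      rw [Set.indicator_of_mem hy, Pi.one_apply]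
      refine (ENNReal.add_le_add_iff_right ENNReal.one_ne_top).1 ?_
      calc 1 + 2 * ∑ j ∈ Finset.range m, hitAfter ν B (j + 1) y + 1
          = 2 * (∑ j ∈ Finset.range m, hitAfter ν B (j + 1) y + 1) := by ring
        _ = 2 * (∑ j ∈ Finset.range m, hitAfter ν B j y + hitAfter ν B m y) := by rw [htel]
        _ ≤ 2 * (∑ j ∈ Finset.range m, hitAfter ν B j y + 1 / 2) := by gcongr
        _ = 2 * ∑ j ∈ Finset.range m, hitAfter ν B j y + 1 := by
          rw [mul_add, one_div, ENNReal.mul_inv_cancel two_ne_zero ENNReal.ofNat_ne_top]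
    · rw [Set.indicator_of_notMem hy, zero_add]
      gcongr with j
      exact hitAfter_anti ν (Nat.le_succ j) y

/-! ### Green bound for centered walks of finite variance -/

section Centered

open Filter Topology

/-- A superharmonic function for a centered random walk killed below `0`, with a concave kink
at `R`. -/
def tent (R z : ℝ) : ℝ := if 0 ≤ z then 16 * R ^ 2 - max (2 * R - z) R ^ 2 else 0

theorem measurable_tent (R : ℝ) : Measurable (tent R) := by
  unfold tent
  refine Measurable.ite measurableSet_Ici ?_ measurable_const
  fun_prop

theorem tent_nonneg {R : ℝ} (hR : 0 < R) (z : ℝ) : 0 ≤ tent R z := by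
  unfold tent
  split_ifs with h
  · rcases max_cases (2 * R - z) R with ⟨e, _⟩ | ⟨e, _⟩ <;> rw [e] <;> nlinarith
  · rfl

theorem tent_le {R : ℝ} (hR : 0 < R) (z : ℝ) : tent R z ≤ 15 * R ^ 2 := by
  unfold tent
  split_ifs with h
  · nlinarith [le_max_right (2 * R - z) R]
  · positivity

theorem tent_of_le {R z : ℝ} (hz : 0 ≤ z) (hzR : z ≤ R) :
    tent R z = 16 * R ^ 2 - (2 * R - z) ^ 2 := by
  rw [tent, if_pos hz, max_eq_left (by linarith)]

theorem tent_of_ge {R z : ℝ} (hz : 0 ≤ z) (hzR : R ≤ z) : tent R z = 15 * R ^ 2 := by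
  rw [tent, if_pos hz, max_eq_right (by linarith)]
  ring

/-- On [0,R] the function is the parabola 16R² - (2R-z)², and beyond R it is flat and below the
tangent at y. For a jump below 0 the parabola is still nonnegative when x ≥ -2R, because then 2R-y-x
≤ 4R; this fixes the constant 16. For longer jumps (2R-y-x)² ≤ 4x² gives the correction. -/
theorem tent_add_le {R y : ℝ} (hR : 0 < R) (hy : 0 ≤ y) (hyR : y ≤ R) (x : ℝ) :
    tent R (y + x) ≤ tent R y + 2 * (2 * R - y) * x - max (-x) 0 ^ 2
      + (Set.Iio (-(2 * R))).indicator (fun x => 4 * x ^ 2) x := by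
  rw [tent_of_le hy hyR]
  have hind : 0 ≤ (Set.Iio (-(2 * R))).indicator (fun x : ℝ => 4 * x ^ 2) x :=
    Set.indicator_nonneg (fun x _ => by positivity) x
  rcases lt_or_ge (y + x) 0 with hz | hz
  · rw [tent, if_neg (not_le.2 hz), max_eq_left (by linarith : (0 : ℝ) ≤ -x)]
    by_cases hx : x < -(2 * R)
    · rw [Set.indicator_of_mem (Set.mem_Iio.2 hx)]
      nlinarith
    · nlinarith
  · rcases le_total (y + x) R with hzR | hzR
    · rw [tent_of_le hz hzR]
      rcases max_cases (-x) 0 with ⟨e, _⟩ | ⟨e, _⟩ <;> rw [e] <;> nlinarith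
    · rw [tent_of_ge hz hzR, max_eq_right (by linarith : -x ≤ 0)]
      nlinarith

/-- A jump from just left of R lands at least δ beyond it and at most at 2R, where the flat part
lies below the continued parabola by at least R² - (R-δ)² ≥ Rδ. -/
theorem tent_add_le_of_kink {R y δ x : ℝ} (hδ : 0 < δ) (hδR : δ ≤ R) (hy : R - δ ≤ y)
    (hyR : y ≤ R) (hx : 2 * δ ≤ x) (hxR : x ≤ R) :
    tent R (y + x) ≤ tent R y + 2 * (2 * R - y) * x - x ^ 2 - R * δ := by
  rw [tent_of_le (by linarith) hyR, tent_of_ge (by linarith) (by linarith)]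
  nlinarith

/-- Integrating the pointwise bounds, the linear term vanishes because the walk is centered, the
negative half of the variance pays for the long negative jumps, and the gain at the kink remains.
For y > R the function is already at its maximum. -/
theorem integral_tent_le {ν : Measure ℝ} [IsProbabilityMeasure ν]
    (hsq : Integrable (fun x => x ^ 2) ν) (hid : Integrable (fun x => x) ν)
    (hmean : ∫ x, x ∂ν = 0) {R δ : ℝ} (hR : 0 < R) (hδ : 0 < δ) (hδR : δ ≤ R)
    (htail : ∫ x in Set.Iio (-(2 * R)), 4 * x ^ 2 ∂ν ≤ ∫ x, max (-x) 0 ^ 2 ∂ν)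
    {y : ℝ} (hy : 0 ≤ y) :
    ∫ x, tent R (y + x) ∂ν + R * δ * ν.real (Set.Icc (2 * δ) R) *
      (Set.Ico (R - δ) R).indicator 1 y ≤ tent R y := by
  have hbdd : ∀ y, Integrable (fun x => tent R (y + x)) ν := by
    intro y
    refine Integrable.of_bound (C := 15 * R ^ 2)
      ((measurable_tent R).comp (measurable_const_add y)).aestronglyMeasurable
      (Eventually.of_forall fun x => ?_)
    rw [Real.norm_of_nonneg (tent_nonneg hR _)]
    exact tent_le hR _
  rcases lt_or_ge R y with hyR | hyR
  · rw [Set.indicator_of_notMem (fun h => absurd h.2 (not_lt.2 hyR.le)), mul_zero, add_zero,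
      tent_of_ge hy hyR.le]
    calc ∫ x, tent R (y + x) ∂ν ≤ ∫ _, 15 * R ^ 2 ∂ν :=
          integral_mono (hbdd y) (integrable_const _) fun x => tent_le hR _
      _ = 15 * R ^ 2 := by simp
  have hminus : Integrable (fun x : ℝ => max (-x) 0 ^ 2) ν := by
    refine hsq.mono' (by fun_prop) (Eventually.of_forall fun x => ?_)
    rw [Real.norm_of_nonneg (by positivity)]
    rcases max_cases (-x) 0 with ⟨e, _⟩ | ⟨e, _⟩ <;> rw [e] <;> nlinarith
  have hfar : Integrable ((Set.Iio (-(2 * R))).indicator fun x : ℝ => 4 * x ^ 2) ν :=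
    (hsq.const_mul 4).indicator measurableSet_Iio
  have hkink : Integrable ((Set.Icc (2 * δ) R).indicator fun _ : ℝ => R * δ) ν :=
    (integrable_const _).indicator measurableSet_Icc
  set c : ℝ := (Set.Ico (R - δ) R).indicator 1 y with hc
  have hpt : ∀ x, tent R (y + x) ≤ tent R y + 2 * (2 * R - y) * x - max (-x) 0 ^ 2
      + (Set.Iio (-(2 * R))).indicator (fun x => 4 * x ^ 2) x
      - c * (Set.Icc (2 * δ) R).indicator (fun _ => R * δ) x := by
    intro x
    have h1 := tent_add_le hR hy hyR x
    by_cases hyB : y ∈ Set.Ico (R - δ) R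
    · rw [hc, Set.indicator_of_mem hyB, Pi.one_apply, one_mul]
      by_cases hx : x ∈ Set.Icc (2 * δ) R
      · have h2 := tent_add_le_of_kink hδ hδR hyB.1 hyR hx.1 hx.2
        have hx0 : 0 < x := by linarith [hx.1]
        rw [Set.indicator_of_mem hx, Set.indicator_of_notMem (by simp; linarith),
          max_eq_right (by linarith : -x ≤ 0)]
        nlinarith
      · rw [Set.indicator_of_notMem hx]
        linarith
    · rw [hc, Set.indicator_of_notMem hyB]
      linarith
  have i1 : Integrable (fun x => tent R y + 2 * (2 * R - y) * x) ν :=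
    (integrable_const _).add (hid.const_mul _)
  have i2 : Integrable (fun x => tent R y + 2 * (2 * R - y) * x - max (-x) 0 ^ 2) ν := i1.sub hminus
  have i3 : Integrable (fun x => tent R y + 2 * (2 * R - y) * x - max (-x) 0 ^ 2
      + (Set.Iio (-(2 * R))).indicator (fun x => 4 * x ^ 2) x) ν := i2.add hfar
  have hint := integral_mono (hbdd y) (i3.sub (hkink.const_mul c)) hpt
  simp only [Pi.sub_apply] at hint
  rw [integral_sub i3 (hkink.const_mul c), integral_add i2 hfar, integral_sub i1 hminus,
    integral_add (integrable_const _) (hid.const_mul _), integral_const_mul, hmean,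
    integral_const_mul, integral_indicator measurableSet_Iio, integral_indicator measurableSet_Icc,
    setIntegral_const, integral_const, probReal_univ, one_smul, smul_eq_mul] at hint
  linarith

/-- The three constants of the recurrent case: a scale `δ`, a range `R₀`, and the negative
part of the variance dominating the tail. -/
theorem exists_scale {ν : Measure ℝ} [IsProbabilityMeasure ν]
    (hsq : Integrable (fun x => x ^ 2) ν) (hid : Integrable (fun x => x) ν)
    (hmean : ∫ x, x ∂ν = 0) (hvar : 0 < ∫ x, x ^ 2 ∂ν) :
    ∃ δ R₀ : ℝ, 0 < δ ∧ δ ≤ 1 ∧ 1 ≤ R₀ ∧ 0 < ν.real (Set.Icc (2 * δ) R₀) ∧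
      ∀ R ≥ R₀, ∫ x in Set.Iio (-(2 * R)), 4 * x ^ 2 ∂ν ≤ ∫ x, max (-x) 0 ^ 2 ∂ν := by
  have hne : ¬ ∀ᵐ x ∂ν, x = 0 := by
    intro h
    have : ∫ x, x ^ 2 ∂ν = 0 := integral_eq_zero_of_ae (h.mono fun x hx => by simp [hx])
    linarith
  have hposmeas : ν (Set.Ioi 0) ≠ 0 := by
    intro h
    refine hne ?_
    have hle : ∀ᵐ x ∂ν, 0 ≤ -x := by
      rw [measure_eq_zero_iff_ae_notMem] at h
      filter_upwards [h] with x hx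
      simpa using hx
    have := (integral_eq_zero_iff_of_nonneg_ae hle hid.neg).1 (by
      rw [integral_neg, hmean, neg_zero])
    exact this.mono fun x hx => by simpa using hx
  have hminus : Integrable (fun x : ℝ => max (-x) 0 ^ 2) ν := by
    refine hsq.mono' (by fun_prop) (Eventually.of_forall fun x => ?_)
    rw [Real.norm_of_nonneg (by positivity)]
    rcases max_cases (-x) 0 with ⟨e, _⟩ | ⟨e, _⟩ <;> rw [e] <;> nlinarith
  have hs : 0 < ∫ x, max (-x) 0 ^ 2 ∂ν := by
    refine lt_of_le_of_ne (integral_nonneg fun x => by positivity) fun h => hne ?_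
    have h0 := (integral_eq_zero_iff_of_nonneg (fun x => by positivity) hminus).1 h.symm
    have hge : ∀ᵐ x ∂ν, 0 ≤ x := by
      filter_upwards [h0] with x hx
      have : max (-x) 0 = 0 := by simpa using hx
      simpa using this
    exact (integral_eq_zero_iff_of_nonneg_ae hge hid).1 hmean
  -- The intervals [2/(n+1), n] cover (0,∞), which is charged since the law is centered and not
  -- concentrated at 0.
  obtain ⟨n, hn⟩ : ∃ n : ℕ, ν (Set.Icc (2 * (1 / ((n : ℝ) + 1))) n) ≠ 0 := by
    by_contra! hall
    refine hposmeas (measure_mono_null (fun x hx => ?_) (measure_iUnion_null hall))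
    obtain ⟨n, hn⟩ := exists_nat_ge (max x (2 / x))
    refine Set.mem_iUnion.2 ⟨n, ?_, (le_max_left _ _).trans hn⟩
    have hx : 0 < x := hx
    have : 2 / x ≤ n := (le_max_right _ _).trans hn
    rw [div_le_iff₀ hx] at this
    rw [mul_one_div, div_le_iff₀ (by positivity)]
    nlinarith
  have htail : Tendsto (fun m : ℕ => ∫ x in Set.Iio (-(2 * (m : ℝ))), 4 * x ^ 2 ∂ν) atTop (𝓝 0) := by
    have := Antitone.tendsto_setIntegral (μ := ν) (f := fun x : ℝ => 4 * x ^ 2)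
      (s := fun m : ℕ => Set.Iio (-(2 * (m : ℝ)))) (fun m => measurableSet_Iio)
      (fun i j hij => Set.Iio_subset_Iio (by
        have : (i : ℝ) ≤ j := by exact_mod_cast hij
        linarith)) (hsq.const_mul 4).integrableOn
    have hemp : ⋂ m : ℕ, Set.Iio (-(2 * (m : ℝ))) = ∅ := by
      ext x
      simp only [Set.mem_iInter, Set.mem_Iio, Set.mem_empty_iff_false, iff_false, not_forall,
        not_lt]
      obtain ⟨m, hm⟩ := exists_nat_ge (-x)
      exact ⟨m, by linarith [(Nat.cast_nonneg m : (0 : ℝ) ≤ m)]⟩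
    rwa [hemp, setIntegral_empty] at this
  obtain ⟨m, hm⟩ := (htail.eventually_lt_const hs).exists
  refine ⟨1 / (n + 1), max (max n m) 1, by positivity, ?_, le_max_right _ _, ?_, ?_⟩
  · rw [div_le_one (by positivity)]
    linarith [(Nat.cast_nonneg n : (0 : ℝ) ≤ n)]
  · refine (ENNReal.toReal_pos hn (measure_ne_top _ _)).trans_le (measureReal_mono (Set.Icc_subset_Icc_right ?_))
    exact (le_max_left _ _).trans (le_max_left _ _)
  · intro R hR
    refine le_trans (setIntegral_mono_set (hsq.const_mul 4).integrableOn
      (Eventually.of_forall fun x => by positivity)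
      (Set.Iio_subset_Iio ?_).eventuallyLE) hm.le
    have : (m : ℝ) ≤ R := le_trans ((le_max_right _ _).trans (le_max_left _ _)) hR
    linarith

/-- Shift by K + R₀ and put the kink at the right end of the target interval, which becomes [R-δ,R).
The gain there is at least Rδq, so divide by it; the maximum 15R² becomes 15R/(δq), linear in |k|.
-/
theorem greenBound_of_mean_zero (ν : Measure ℝ) [IsProbabilityMeasure ν]
    (hsq : Integrable (fun x => x ^ 2) ν) (hid : Integrable (fun x => x) ν)
    (hmean : ∫ x, x ∂ν = 0) (hvar : 0 < ∫ x, x ^ 2 ∂ν) :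
    ∃ δ : ℝ, 0 < δ ∧ δ ≤ 1 ∧ GreenBound ν δ 1 := by
  obtain ⟨δ, R₀, hδ, hδ1, hR₀, hq, htail⟩ := exists_scale hsq hid hmean hvar
  refine ⟨δ, hδ, hδ1, fun K => ?_⟩
  set q := ν.real (Set.Icc (2 * δ) R₀) with hqdef
  refine ⟨15 * (1 + |K| + R₀) / (δ * q), fun k => ?_⟩
  set R : ℝ := (k + 1) * δ + K + R₀ with hRdef
  rcases lt_or_ge R R₀ with hRR | hRR
  -- R < R₀ means that the interval lies entirely below -K.
  · refine ⟨0, measurable_const, fun y => bot_le, fun y hy => ?_⟩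
    rw [Set.indicator_of_notMem]
    · simp
    · intro hmem
      have := hmem.2
      linarith
  have hR : 0 < R := by linarith
  have hqR : q ≤ ν.real (Set.Icc (2 * δ) R) := measureReal_mono (Set.Icc_subset_Icc_right hRR)
  have hc : 0 < R * δ * q := by positivity
  refine ⟨fun z => ENNReal.ofReal (tent R (z + (K + R₀)) / (R * δ * q)), ?_, ?_, ?_⟩
  · exact (((measurable_tent R).comp (measurable_add_const _)).div_const _).ennreal_ofReal
  · intro z
    refine ENNReal.ofReal_le_ofReal ?_
    have hRle : R ≤ (1 + |K| + R₀) * (1 + |(k : ℝ)|) := by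
      have h1 : ((k : ℝ) + 1) * δ ≤ |(k : ℝ)| + 1 := by
        rcases le_total 0 ((k : ℝ) + 1) with h | h
        · nlinarith [le_abs_self (k : ℝ)]
        · nlinarith [abs_nonneg (k : ℝ)]
      nlinarith [le_abs_self K, abs_nonneg K, abs_nonneg (k : ℝ),
        mul_nonneg (abs_nonneg K) (abs_nonneg (k : ℝ))]
    rw [div_le_iff₀ hc, pow_one]
    have he : 15 * (1 + |K| + R₀) / (δ * q) * (1 + |(k : ℝ)|) * (R * δ * q)
        = 15 * R * ((1 + |K| + R₀) * (1 + |(k : ℝ)|)) := by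
      field_simp
    rw [he]
    nlinarith [tent_le hR (z + (K + R₀))]
  · intro y hy
    have hm : Measurable fun z => tent R (y + z + (K + R₀)) / (R * δ * q) :=
      ((measurable_tent R).comp ((measurable_const_add y).add_const _)).div_const _
    have hnn : ∀ z, 0 ≤ tent R (y + z + (K + R₀)) / (R * δ * q) := fun z =>
      div_nonneg (tent_nonneg hR _) hc.le
    have hbd : Integrable (fun z => tent R (y + z + (K + R₀)) / (R * δ * q)) ν := by
      refine Integrable.of_bound (C := 15 * R ^ 2 / (R * δ * q)) hm.aestronglyMeasurable
        (Eventually.of_forall fun x => ?_)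
      rw [Real.norm_of_nonneg (hnn x)]
      gcongr
      exact tent_le hR _
    have hind : (Set.Ico (k * δ) ((k + 1) * δ)).indicator (1 : ℝ → ℝ≥0∞) y
        = ENNReal.ofReal ((Set.Ico (R - δ) R).indicator 1 (y + (K + R₀))) := by
      have : y ∈ Set.Ico (k * δ) ((k + 1) * δ) ↔ y + (K + R₀) ∈ Set.Ico (R - δ) R := by
        simp only [Set.mem_Ico, hRdef]
        constructor <;> rintro ⟨h1, h2⟩ <;> constructor <;> linarith
      by_cases h : y ∈ Set.Ico (k * δ) ((k + 1) * δ)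
      · rw [Set.indicator_of_mem h, Set.indicator_of_mem (this.1 h)]; simp
      · rw [Set.indicator_of_notMem h, Set.indicator_of_notMem (mt this.2 h)]; simp
    have hind0 : 0 ≤ (Set.Ico (R - δ) R).indicator (1 : ℝ → ℝ) (y + (K + R₀)) :=
      Set.indicator_nonneg (fun _ _ => zero_le_one) _
    rw [← ofReal_integral_eq_lintegral_ofReal hbd (Eventually.of_forall hnn), hind,
      ← ENNReal.ofReal_add hind0 (integral_nonneg hnn)]
    refine ENNReal.ofReal_le_ofReal ?_
    have hmain := integral_tent_le hsq hid hmean hR hδ (by linarith) (htail R hRR)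
      (y := y + (K + R₀)) (by linarith)
    rw [integral_div, ← sub_nonneg]
    have hcomm : ∀ z, y + z + (K + R₀) = y + (K + R₀) + z := fun z => by ring
    simp only [hcomm]
    have hfac : R * δ * q * (Set.Ico (R - δ) R).indicator (1 : ℝ → ℝ) (y + (K + R₀)) ≤
        R * δ * ν.real (Set.Icc (2 * δ) R) *
          (Set.Ico (R - δ) R).indicator (1 : ℝ → ℝ) (y + (K + R₀)) := by gcongr
    rw [sub_nonneg, ← le_sub_iff_add_le, ← sub_div, le_div_iff₀ hc]
    linarith

end Centered

/-! ### Lower bound on positions and visit counts along branches -/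

section LocalTime

variable {Ω : Type*} [MeasurableSpace Ω]

open Classical in
/-- The number of strict ancestors of `u` located in `B`. -/
def visits (d : Vertex → Offspring) (B : Set ℝ) : Vertex → ℕ
  | [] => 0
  | _ :: u => visits d B u + if position d u ∈ B then 1 else 0

open Classical in
/-- The factor `ρ` on `B`, with killing below `-K`. -/
def visitFactor (K : ℝ) (B : Set ℝ) (ρ : ℝ≥0∞) (y : ℝ) : ℝ≥0∞ :=
  if -K ≤ y then (if y ∈ B then ρ else 1) else 0

theorem measurable_visitFactor (K : ℝ) {B : Set ℝ} (hB : MeasurableSet B) (ρ : ℝ≥0∞) :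
    Measurable (visitFactor K B ρ) :=
  Measurable.ite measurableSet_Ici (Measurable.ite hB measurable_const measurable_const)
    measurable_const

/-- On a tree that stays above -K the killing never acts, so only the displacement and visit factors
remain. -/
theorem mass_visitFactor {t K : ℝ} {d : Vertex → Offspring} {B : Set ℝ} {ρ : ℝ≥0∞}
    (hK : ∀ u, InTree d u → -K ≤ position d u) :
    ∀ u, InTree d u → mass t (visitFactor K B ρ) d u
      = ENNReal.ofReal (Real.exp (-t * position d u)) * ρ ^ visits d B u := by
  intro u
  induction u with
  | nil => intro _; simp [mass, position, visits]
  | cons i u ih =>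
    rintro ⟨hu, hi⟩
    have hexp : ENNReal.ofReal (Real.exp (-t * position d (i :: u)))
        = ENNReal.ofReal (Real.exp (-t * position d u)) *
          ENNReal.ofReal (Real.exp (-t * (d u).2 i)) := by
      rw [← ENNReal.ofReal_mul (Real.exp_pos _).le, ← Real.exp_add, position, mul_add]
    rw [mass, ih hu, if_pos hi, hexp, visits]
    by_cases hB : position d u ∈ B
    · rw [visitFactor, if_pos (hK u hu), if_pos hB, if_pos hB, pow_succ]
      ring
    · rw [visitFactor, if_pos (hK u hu), if_neg hB, if_neg hB]
      ring

/-- Follow the branch to its first vertex below -K: the factors involve strict ancestors only, so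
the mass is not yet killed there. -/
theorem exists_mass_of_lt {t K : ℝ} {d : Vertex → Offspring} {r : ℝ → ℝ≥0∞} (hK : 0 ≤ K)
    (hr : ∀ y, -K ≤ y → r y = 1) (u : Vertex) (hu : InTree d u) :
    (∃ v, position d v < -K ∧ mass t r d v = ENNReal.ofReal (Real.exp (-t * position d v))) ∨
      (-K ≤ position d u ∧ mass t r d u = ENNReal.ofReal (Real.exp (-t * position d u))) := by
  induction u with
  | nil => right; simp [mass, position, hK]
  | cons i u ih =>
    obtain ⟨hu, hi⟩ := hu
    rcases ih hu with h | ⟨h, hm⟩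
    · exact Or.inl h
    have hmass : mass t r d (i :: u) = ENNReal.ofReal (Real.exp (-t * position d (i :: u))) := by
      rw [mass, hm, hr _ h, mul_one, if_pos hi, ← ENNReal.ofReal_mul (Real.exp_pos _).le,
        ← Real.exp_add, position, mul_add]
    rcases lt_or_ge (position d (i :: u)) (-K) with h' | h'
    · exact Or.inl ⟨_, h', hmass⟩
    · exact Or.inr ⟨h', hmass⟩

variable {P : Measure Ω} [IsProbabilityMeasure P] {D : Vertex → Ω → Offspring}

/-- The branching random walk is bounded below. -/
theorem ae_bddBelow (hD : IsBranchingRandomWalk P D) {t : ℝ} (ht : 0 < t)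
    [IsProbabilityMeasure (tilt t (intensity P D))] :
    ∀ᵐ ω ∂P, ∃ K : ℕ, ∀ u, InTree (fun v => D v ω) u → -(K : ℝ) ≤ position (fun v => D v ω) u := by
  rw [ae_iff]
  set bad := {ω | ¬ ∃ K : ℕ, ∀ u, InTree (fun v => D v ω) u →
    -(K : ℝ) ≤ position (fun v => D v ω) u}
  have hbad : ∀ K : ℕ, ENNReal.ofReal (Real.exp (t * K)) * P bad ≤ 1 := by
    intro K
    -- With r killing below -K and f counting positions there, only first passages contribute, each
    -- at least e^{tK}; the constant 1 is superharmonic.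
    let r : ℝ → ℝ≥0∞ := (Set.Ici (-(K : ℝ))).indicator 1
    let f : ℝ → ℝ≥0∞ := (Set.Iio (-(K : ℝ))).indicator 1
    have hr : Measurable r := measurable_one.indicator measurableSet_Ici
    have hf : Measurable f := measurable_one.indicator measurableSet_Iio
    have hm := measurable_apply hD
    have hsum := lintegral_tsum_mass_le hD t (h := fun _ => 1) hr hf measurable_const (by
      intro y
      rw [lintegral_const, measure_univ, mul_one, mul_one]
      rcases lt_or_ge y (-(K : ℝ)) with h | h
      · simp [r, f, h]
      · simp [r, f, h])
    refine le_trans ?_ ((mul_meas_ge_le_lintegral ?_ (ENNReal.ofReal (Real.exp (t * K)))).trans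
      hsum)
    · gcongr
      intro ω hω
      simp only [bad, Set.mem_ofPred_eq, not_exists, not_forall] at hω
      obtain ⟨u, hu, hlt⟩ := hω K
      rcases exists_mass_of_lt (t := t) (Nat.cast_nonneg K) (r := r)
        (fun y hy => by simp [r, hy]) u hu with ⟨v, hv, hmass⟩ | h
      · refine le_trans ?_ (ENNReal.le_tsum v)
        have hf1 : f (position (fun v => D v ω) v) = 1 := by simp [f, hv]
        rw [hmass, hf1, mul_one]
        refine ENNReal.ofReal_le_ofReal (Real.exp_le_exp.2 ?_)
        nlinarith
      · exact absurd h.1 hlt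
    · exact Measurable.tsum fun u => ((measurable_mass t hr u).comp hm).mul
        (hf.comp ((measurable_position u).comp hm))
  by_contra hne
  have hpos : 0 < (P bad).toReal := ENNReal.toReal_pos hne (measure_ne_top _ _)
  obtain ⟨K, hK⟩ := exists_nat_gt (1 / (t * (P bad).toReal))
  have h1 := hbad K
  rw [← ENNReal.ofReal_toReal (measure_ne_top P bad), ← ENNReal.ofReal_mul (Real.exp_pos _).le,
    ← ENNReal.ofReal_one, ENNReal.ofReal_le_ofReal_iff zero_le_one] at h1
  rw [div_lt_iff₀ (by positivity)] at hK
  have h2 := Real.add_one_le_exp (t * K)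
  nlinarith

/-- Exponential moments of the number of visits to `B` along the branches of the tree, weighted by
`e^{-tV}`, while the branch stays above `-K`. -/
theorem lintegral_visits_le (hD : IsBranchingRandomWalk P D) {t : ℝ}
    [IsProbabilityMeasure (tilt t (intensity P D))] {B : Set ℝ} (hB : MeasurableSet B) {G K : ℝ}
    (hG : 1 ≤ G) {g : ℝ → ℝ≥0∞} (hg : Measurable g) (hgG : ∀ y, g y ≤ ENNReal.ofReal G)
    (hgreen : ∀ y, -K ≤ y →
      B.indicator 1 y + ∫⁻ z, g (y + z) ∂(tilt t (intensity P D)) ≤ g y) :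
    ∫⁻ ω, ∑' u, mass t (visitFactor K B (ENNReal.ofReal (1 + 1 / (4 * G)))) (fun v => D v ω) u *
      (B ∩ Set.Ici (-K)).indicator 1 (position (fun v => D v ω) u) ∂P ≤ ENNReal.ofReal (4 * G) := by
  have hr := measurable_visitFactor K hB (ENNReal.ofReal (1 + 1 / (4 * G)))
  have hh : Measurable fun y => ENNReal.ofReal (2 * G) + 2 * g y :=
    measurable_const.add (hg.const_mul 2)
  -- The function 2G + 2g is at most 4G. On B one step lowers it by at least 2: the extra factor
  -- 1/(4G) costs at most 1, and 1 is left for the count.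
  refine (lintegral_tsum_mass_le hD t (h := fun y => ENNReal.ofReal (2 * G) + 2 * g y) hr
    (measurable_one.indicator (hB.inter measurableSet_Ici)) hh ?_).trans ?_
  · intro y
    by_cases hy : -K ≤ y
    swap
    · simp [hy, visitFactor]
    have hgy := hgreen y hy
    have hm : Measurable fun z => g (y + z) := hg.comp (measurable_const_add y)
    rw [lintegral_add_left measurable_const, lintegral_const, measure_univ, mul_one,
      lintegral_const_mul _ hm, visitFactor, if_pos hy]
    by_cases hyB : y ∈ B
    · rw [if_pos hyB, Set.indicator_of_mem (Set.mem_inter hyB (Set.mem_Ici.2 hy))]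
      rw [Set.indicator_of_mem hyB] at hgy
      simp only [Pi.one_apply] at hgy ⊢
      have hgfin : g y ≠ ∞ := ne_top_of_le_ne_top ENNReal.ofReal_ne_top (hgG y)
      have hPfin : ∫⁻ z, g (y + z) ∂(tilt t (intensity P D)) ≠ ∞ :=
        ne_top_of_le_ne_top hgfin (le_add_self.trans hgy)
      have hb := hgG y
      obtain ⟨a, ha⟩ : ∃ a, a = ∫⁻ z, g (y + z) ∂(tilt t (intensity P D)) := ⟨_, rfl⟩
      rw [← ha] at hPfin hgy ⊢
      lift a to NNReal using hPfin
      obtain ⟨b, hb'⟩ : ∃ b, b = g y := ⟨_, rfl⟩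
      rw [← hb'] at hgfin hgy hb ⊢
      lift b to NNReal using hgfin
      have h1 : (1 : ℝ) + a ≤ b := by exact_mod_cast hgy
      have h2 : (b : ℝ) ≤ G := by
        rw [← ENNReal.ofReal_coe_nnreal, ENNReal.ofReal_le_ofReal_iff (by linarith)] at hb
        exact hb
      have ha0 : (0 : ℝ) ≤ a := a.2
      rw [← ENNReal.ofReal_coe_nnreal, ← ENNReal.ofReal_coe_nnreal, ← ENNReal.ofReal_ofNat 2,
        ← ENNReal.ofReal_one, ← ENNReal.ofReal_mul (by positivity),
        ← ENNReal.ofReal_mul (by positivity),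
        ← ENNReal.ofReal_add (by positivity) (by positivity),
        ← ENNReal.ofReal_add (by positivity) (by positivity),
        ← ENNReal.ofReal_mul (by positivity),
        ← ENNReal.ofReal_add (by positivity) (by positivity)]
      refine ENNReal.ofReal_le_ofReal ?_
      have : 1 / (4 * G) * (2 * G + 2 * (a : ℝ)) ≤ 1 := by
        rw [div_mul_eq_mul_div, div_le_one (by positivity)]
        linarith
      nlinarith
    · rw [if_neg hyB, Set.indicator_of_notMem (fun h => hyB h.1), one_mul, add_zero]
      rw [Set.indicator_of_notMem hyB, zero_add] at hgy
      gcongr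
  · calc ENNReal.ofReal (2 * G) + 2 * g 0
        ≤ ENNReal.ofReal (2 * G) + 2 * ENNReal.ofReal G := by gcongr; exact hgG 0
      _ = ENNReal.ofReal (4 * G) := by
        rw [← ENNReal.ofReal_ofNat 2, ← ENNReal.ofReal_mul zero_le_two,
          ← ENNReal.ofReal_add (by positivity) (by positivity)]
        congr 1
        ring

theorem summable_one_add_abs_int_rpow {s : ℝ} (hs : 1 < s) :
    Summable fun k : ℤ => (1 + |(k : ℝ)|) ^ (-s) := by
  refine Summable.of_norm_bounded_eventually (Real.summable_abs_int_rpow hs) ?_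
  filter_upwards [(Set.finite_singleton (0 : ℤ)).compl_mem_cofinite] with k hk
  have hk0 : 0 < |(k : ℝ)| := abs_pos.2 (by exact_mod_cast hk)
  rw [Real.norm_of_nonneg (by positivity)]
  exact Real.rpow_le_rpow_of_nonpos hk0 (by linarith) (by linarith)

/-- From e^x ≤ 1 + 2x at x = 1/(8G); this makes the visit count appear in an exponent. -/
theorem exp_div_le_pow {G : ℝ} (hG : 1 ≤ G) (N : ℕ) :
    Real.exp (N / (8 * G)) ≤ (1 + 1 / (4 * G)) ^ N := by
  have hG0 : 0 < G := by linarith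
  have hx : 1 / (8 * G) ≤ 1 / 8 := by
    rw [div_le_div_iff₀ (by positivity) (by positivity)]; linarith
  have hx0 : 0 < 1 / (8 * G) := by positivity
  have h := (abs_le.1 (Real.abs_exp_sub_one_sub_id_le (x := 1 / (8 * G))
    (by rw [abs_of_pos hx0]; linarith))).2
  have he : 1 / (4 * G) = 2 * (1 / (8 * G)) := by field_simp; norm_num
  have hbase : Real.exp (1 / (8 * G)) ≤ 1 + 1 / (4 * G) := by rw [he]; nlinarith
  calc Real.exp (N / (8 * G)) = Real.exp (1 / (8 * G)) ^ N := by
        rw [← Real.exp_nat_mul]; congr 1; ring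
    _ ≤ _ := pow_le_pow_left₀ (Real.exp_pos _).le hbase N

/-- Every branch visits the interval `[kδ, (k+1)δ)` at most `O((1 + |k|) ^ (p + 1))` times. -/
theorem ae_visits_le (hD : IsBranchingRandomWalk P D) {t : ℝ} (ht : 0 < t)
    [IsProbabilityMeasure (tilt t (intensity P D))] {δ : ℝ} (hδ : 0 < δ) {p : ℕ}
    (hgreen : GreenBound (tilt t (intensity P D)) δ p) (K : ℝ) :
    ∀ᵐ ω ∂P, (∀ u, InTree (fun v => D v ω) u → -K ≤ position (fun v => D v ω) u) →
      ∃ C : ℝ, ∀ (k : ℤ) (u : Vertex), InTree (fun v => D v ω) u →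
        position (fun v => D v ω) u ∈ Set.Ico (k * δ) ((k + 1) * δ) →
        (visits (fun v => D v ω) (Set.Ico (k * δ) ((k + 1) * δ)) u : ℝ)
          ≤ C * (1 + |(k : ℝ)|) ^ (p + 1) := by
  obtain ⟨C₀, hC₀⟩ := hgreen K
  choose g hgm hgle hg using hC₀
  let C := max C₀ 1
  have hC1 : 1 ≤ C := le_max_right _ _
  let G : ℤ → ℝ := fun k => C * (1 + |(k : ℝ)|) ^ p
  have hG1 : ∀ k, 1 ≤ G k := fun k =>
    one_le_mul_of_one_le_of_one_le hC1 (one_le_pow₀ (by linarith [abs_nonneg (k : ℝ)]))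
  have hgG : ∀ k y, g k y ≤ ENNReal.ofReal (G k) := fun k y =>
    (hgle k y).trans (ENNReal.ofReal_le_ofReal
      (mul_le_mul_of_nonneg_right (le_max_left _ _) (by positivity)))
  let B : ℤ → Set ℝ := fun k => Set.Ico (k * δ) ((k + 1) * δ)
  have hB : ∀ k, MeasurableSet (B k) := fun k => measurableSet_Ico
  let r : ℤ → ℝ → ℝ≥0∞ := fun k => visitFactor K (B k) (ENNReal.ofReal (1 + 1 / (4 * G k)))
  have hr : ∀ k, Measurable (r k) := fun k => measurable_visitFactor K (hB k) _
  let f : ℤ → ℝ → ℝ≥0∞ := fun k => (B k ∩ Set.Ici (-K)).indicator 1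
  have hf : ∀ k, Measurable (f k) := fun k =>
    measurable_one.indicator ((hB k).inter measurableSet_Ici)
  -- Dividing by the bound 4G_k and inserting (1+|k|)^{-2} makes the expected totals summable over
  -- k.
  let w : ℤ → ℝ := fun k => (1 + |(k : ℝ)|) ^ (-2 : ℝ) / (4 * G k)
  have hw : ∀ k, 0 < w k := fun k => by
    have := hG1 k
    have : 0 < 1 + |(k : ℝ)| := by positivity
    positivity
  let Z : ℤ → Ω → ℝ≥0∞ := fun k ω => ∑' u, mass t (r k) (fun v => D v ω) u *
    f k (position (fun v => D v ω) u)
  have hm := measurable_apply hD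
  have hZm : ∀ k, Measurable (Z k) := fun k =>
    Measurable.tsum fun u => ((measurable_mass t (hr k) u).comp hm).mul
        ((hf k).comp ((measurable_position u).comp hm))
  have hZ : ∀ k, ∫⁻ ω, Z k ω ∂P ≤ ENNReal.ofReal (4 * G k) := fun k =>
    lintegral_visits_le hD (hB k) (hG1 k) (hgm k) (hgG k) (hg k)
  have hfin : ∫⁻ ω, ∑' k, ENNReal.ofReal (w k) * Z k ω ∂P ≠ ∞ := by
    rw [lintegral_tsum fun k => ((hZm k).const_mul _).aemeasurable]
    refine ne_top_of_le_ne_top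
      (summable_one_add_abs_int_rpow (by norm_num : (1 : ℝ) < 2)).tsum_ofReal_ne_top
      (ENNReal.tsum_le_tsum fun k => ?_)
    rw [lintegral_const_mul _ (hZm k)]
    refine (mul_le_mul_right (hZ k) _).trans ?_
    rw [← ENNReal.ofReal_mul (hw k).le]
    refine ENNReal.ofReal_le_ofReal (le_of_eq ?_)
    have := hG1 k
    exact div_mul_cancel₀ _ (by positivity)
  filter_upwards [ae_lt_top' (Measurable.tsum fun k => (hZm k).const_mul _).aemeasurable hfin]
    with ω hω hK
  set z := (∑' k, ENNReal.ofReal (w k) * Z k ω).toReal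
  refine ⟨8 * C * (z + 4 * C + (p + 2 : ℕ) + t * δ), fun k u hu hmem => ?_⟩
  set N := visits (fun v => D v ω) (Set.Ico (k * δ) ((k + 1) * δ)) u with hN
  set V := position (fun v => D v ω) u with hV
  have hmass := mass_visitFactor (t := t) (B := B k)
    (ρ := ENNReal.ofReal (1 + 1 / (4 * G k))) hK u hu
  have hterm : ENNReal.ofReal (w k * (Real.exp (-t * V) * (1 + 1 / (4 * G k)) ^ N))
      ≤ ∑' k, ENNReal.ofReal (w k) * Z k ω := by
    refine le_trans ?_ (ENNReal.le_tsum k)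
    rw [ENNReal.ofReal_mul (hw k).le]
    refine mul_le_mul_right ?_ _
    refine le_trans ?_ (ENNReal.le_tsum u)
    have hf1 : f k V = 1 := Set.indicator_of_mem (Set.mem_inter hmem (Set.mem_Ici.2 (hK u hu))) _
    have := hG1 k
    rw [hf1, mul_one, hmass, ENNReal.ofReal_mul (Real.exp_pos _).le,
      ENNReal.ofReal_pow (by positivity)]
  have hz0 : 0 ≤ z := ENNReal.toReal_nonneg
  have hreal : w k * (Real.exp (-t * V) * (1 + 1 / (4 * G k)) ^ N) ≤ z :=
    (ENNReal.ofReal_le_iff_le_toReal hω.ne).1 hterm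
  set x : ℝ := 1 + |(k : ℝ)| with hx
  have hx1 : 1 ≤ x := by rw [hx]; linarith [abs_nonneg (k : ℝ)]
  have hx0 : 0 < x := by linarith
  have hGk := hG1 k
  have hGpos : 0 < G k := by linarith
  -- The exponent must be linear in x: tV ≤ tδx on the interval, and the polynomial 1/w_k = 4C
  -- x^{p+2} is bounded crudely by exponentials. Multiplying by 8G_k = 8C x^p then gives the power
  -- p+1.
  have hbound : Real.exp (N / (8 * G k)) ≤
      Real.exp (z + 4 * C + (p + 2 : ℕ) * x + t * δ * x) := by
    have hVle : t * V ≤ t * δ * x := by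
      have h1 : V ≤ (k + 1) * δ := hmem.2.le
      have h2 : ((k : ℝ) + 1) * δ ≤ x * δ :=
        mul_le_mul_of_nonneg_right (by rw [hx]; linarith [le_abs_self (k : ℝ)]) hδ.le
      nlinarith
    have hpow : x ^ (p + 2) ≤ Real.exp ((p + 2 : ℕ) * x) := by
      rw [Real.exp_nat_mul]
      exact pow_le_pow_left₀ hx0.le (by linarith [Real.add_one_le_exp x]) _
    have hwk : (w k)⁻¹ = 4 * C * x ^ (p + 2) := by
      simp only [w, G, ← hx]
      rw [Real.rpow_neg hx0.le, Real.rpow_ofNat, inv_div, div_inv_eq_mul]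
      ring
    have hzle : z ≤ Real.exp z := by linarith [Real.add_one_le_exp z]
    have hCle : 4 * C ≤ Real.exp (4 * C) := by linarith [Real.add_one_le_exp (4 * C)]
    calc Real.exp (N / (8 * G k)) ≤ (1 + 1 / (4 * G k)) ^ N := exp_div_le_pow hGk N
      _ = (w k)⁻¹ * (w k * (Real.exp (-t * V) * (1 + 1 / (4 * G k)) ^ N)) * Real.exp (t * V) := by
          have h1 : Real.exp (-t * V) * Real.exp (t * V) = 1 := by
            rw [← Real.exp_add]; simp
          have h2 := (hw k).ne'
          calc (1 + 1 / (4 * G k)) ^ N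
              = ((w k)⁻¹ * w k) * (Real.exp (-t * V) * Real.exp (t * V)) *
                  (1 + 1 / (4 * G k)) ^ N := by rw [h1, inv_mul_cancel₀ h2]; ring
            _ = _ := by ring
      _ ≤ (w k)⁻¹ * z * Real.exp (t * V) := by
          have := hw k
          gcongr
      _ ≤ (Real.exp (4 * C) * Real.exp ((p + 2 : ℕ) * x)) * Real.exp z * Real.exp (t * δ * x) := by
          rw [hwk]
          have : 0 < C := by linarith
          gcongr
      _ = _ := by
          rw [← Real.exp_add, ← Real.exp_add, ← Real.exp_add]
          congr 1
          ring
  rw [Real.exp_le_exp, div_le_iff₀ (by positivity)] at hbound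
  refine hbound.trans ?_
  have hC0 : 0 < C := by linarith
  calc (z + 4 * C + (p + 2 : ℕ) * x + t * δ * x) * (8 * G k)
      ≤ (z * x + 4 * C * x + (p + 2 : ℕ) * x + t * δ * x) * (8 * G k) := by
        refine mul_le_mul_of_nonneg_right ?_ (by positivity)
        linarith [le_mul_of_one_le_right hz0 hx1,
          le_mul_of_one_le_right (by positivity : (0 : ℝ) ≤ 4 * C) hx1]
    _ = _ := by simp only [G, ← hx]; ring

end LocalTime

/-! ### From visit counts to sums along rays -/

section Rays

variable {d : Vertex → Offspring}

open Classical in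
theorem Ray.visits_vertex (ξ : Ray d) (B : Set ℝ) (n : ℕ) (hn : (n : ℕ∞) ≤ ξ.length) :
    visits d B (ξ.vertex n) = ∑ m ∈ Finset.range n,
      if (m : ℕ∞) ≤ ξ.length ∧ position d (ξ.vertex m) ∈ B then 1 else 0 := by
  induction n with
  | zero => simp [ξ.vertex_zero, visits]
  | succ n ih =>
    have hn' : (n : ℕ∞) ≤ ξ.length := le_trans (by exact_mod_cast Nat.le_succ n) hn
    obtain ⟨i, hi⟩ := ξ.vertex_succ n hn
    rw [hi, visits, ih hn', Finset.sum_range_succ]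
    simp [hn']

open Classical in
/-- The total number of visits of a ray to `B`. -/
theorem Ray.tsum_visits_le (ξ : Ray d) {B : Set ℝ} {c : ℝ} (hc : 0 ≤ c)
    (h : ∀ u, InTree d u → position d u ∈ B → (visits d B u : ℝ) ≤ c) :
    ∑' n : ℕ, (if (n : ℕ∞) ≤ ξ.length ∧ position d (ξ.vertex n) ∈ B then 1 else 0 : ℝ≥0∞)
      ≤ ENNReal.ofReal (c + 1) := by
  rw [ENNReal.tsum_eq_iSup_nat]
  refine iSup_le fun n => ?_
  induction n with
  | zero => simp
  | succ n ih =>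
    rw [Finset.sum_range_succ]
    -- At a visit, the earlier ones are counted by `visits` at the current vertex; the current visit
    -- is the +1.
    by_cases hn : (n : ℕ∞) ≤ ξ.length ∧ position d (ξ.vertex n) ∈ B
    · have hv := h _ (ξ.mem_tree n hn.1) hn.2
      have hsum : (∑ m ∈ Finset.range n,
          (if (m : ℕ∞) ≤ ξ.length ∧ position d (ξ.vertex m) ∈ B then 1 else 0 : ℝ≥0∞))
          = (visits d B (ξ.vertex n) : ℝ≥0∞) := by
        rw [ξ.visits_vertex B n hn.1]
        push_cast
        rfl
      rw [hsum, if_pos hn, ENNReal.ofReal_add hc zero_le_one, ENNReal.ofReal_one,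
        ← ENNReal.ofReal_natCast]
      gcongr
    · rw [if_neg hn, add_zero]
      exact ih

/-- A branching random walk whose rays visit `[kδ, (k+1)δ)` at most `O((1 + |k|) ^ q)` times has
finite `Ξ_b` for `b > q + 1`. -/
theorem Xi_lt_top {δ : ℝ} (hδ : 0 < δ) (hδ1 : δ ≤ 1) {q : ℕ} {C : ℝ}
    (hC : ∀ (k : ℤ) (u : Vertex), InTree d u → position d u ∈ Set.Ico (k * δ) ((k + 1) * δ) →
      (visits d (Set.Ico (k * δ) ((k + 1) * δ)) u : ℝ) ≤ C * (1 + |(k : ℝ)|) ^ q)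
    {b : ℝ} (hb : q + 1 < b) : Xi b d < ∞ := by
  classical
  set c : ℝ := max C 0 with hc
  have hb0 : 0 < b := by linarith [(Nat.cast_nonneg q : (0 : ℝ) ≤ q)]
  obtain ⟨B, hB⟩ : ∃ B : ℤ → Set ℝ, ∀ k : ℤ, B k = Set.Ico (k * δ) ((k + 1) * δ) :=
    ⟨_, fun _ => rfl⟩
  simp only [← hB] at hC
  have hsummable : Summable fun k : ℤ =>
      (δ / 2) ^ (-b) * (c + 1) * (1 + |(k : ℝ)|) ^ (-(b - q)) :=
    (summable_one_add_abs_int_rpow (by linarith)).mul_left _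
  refine lt_of_le_of_lt (iSup_le fun ξ => ?_) hsummable.tsum_ofReal_lt_top
  -- On B_k, |k|δ ≤ |V| + δ; with δ ≤ 1 this gives 1 + |V| ≥ (δ/2)(1+|k|).
  have hpoint : ∀ n : ℕ, (if (n : ℕ∞) ≤ ξ.length then
      ENNReal.ofReal ((1 + |position d (ξ.vertex n)|) ^ (-b)) else 0)
      ≤ ∑' k : ℤ, ENNReal.ofReal ((δ / 2 * (1 + |(k : ℝ)|)) ^ (-b)) *
        (if (n : ℕ∞) ≤ ξ.length ∧ position d (ξ.vertex n) ∈ B k then 1 else 0) := by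
    intro n
    split_ifs with hn
    swap
    · exact bot_le
    set V := position d (ξ.vertex n)
    have hk1 : ⌊V / δ⌋ * δ ≤ V := (le_div_iff₀ hδ).1 (Int.floor_le _)
    have hk2 : V < (⌊V / δ⌋ + 1) * δ := (div_lt_iff₀ hδ).1 (Int.lt_floor_add_one _)
    refine le_trans ?_ (ENNReal.le_tsum ⌊V / δ⌋)
    have hVB : V ∈ B ⌊V / δ⌋ := by rw [hB]; exact ⟨hk1, hk2⟩
    rw [if_pos ⟨hn, hVB⟩, mul_one]
    refine ENNReal.ofReal_le_ofReal (Real.rpow_le_rpow_of_nonpos (by positivity) ?_ (by linarith))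
    set k : ℤ := ⌊V / δ⌋
    have : |(k : ℝ)| * δ ≤ |V| + δ := by
      rcases abs_cases (k : ℝ) with ⟨e, _⟩ | ⟨e, _⟩ <;> rw [e]
      · linarith [le_abs_self V]
      · linarith [neg_abs_le V]
    linarith [abs_nonneg V]
  refine (ENNReal.tsum_le_tsum hpoint).trans ?_
  rw [ENNReal.tsum_comm]
  refine ENNReal.tsum_le_tsum fun k => ?_
  rw [ENNReal.tsum_mul_left]
  have hx : 0 < 1 + |(k : ℝ)| := by positivity
  have hc0 : 0 ≤ c := le_max_right _ _
  refine (mul_le_mul_right (ξ.tsum_visits_le (c := c * (1 + |(k : ℝ)|) ^ q) (by positivity)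
    fun u hu huB => (hC k u hu huB).trans ?_) _).trans ?_
  · exact mul_le_mul_of_nonneg_right (le_max_left _ _) (by positivity)
  rw [← ENNReal.ofReal_mul (by positivity)]
  refine ENNReal.ofReal_le_ofReal ?_
  rw [Real.mul_rpow (by positivity) hx.le, neg_sub, sub_eq_add_neg, Real.rpow_add hx,
    Real.rpow_natCast]
  have h1 : 1 ≤ (1 + |(k : ℝ)|) ^ q := one_le_pow₀ (by linarith [abs_nonneg (k : ℝ)])
  calc (δ / 2) ^ (-b) * (1 + |(k : ℝ)|) ^ (-b) * (c * (1 + |(k : ℝ)|) ^ q + 1)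
      ≤ (δ / 2) ^ (-b) * (1 + |(k : ℝ)|) ^ (-b) *
          (c * (1 + |(k : ℝ)|) ^ q + (1 + |(k : ℝ)|) ^ q) := by gcongr
    _ = _ := by ring

/-- For x ≥ 0 use y⁴/4! ≤ e^y at y = 1 + x; on [-K,0] both factors are bounded. The exponent 4
exceeds both thresholds, 2 and 3. -/
theorem exp_neg_le {K x : ℝ} (hK : 0 ≤ K) (hx : -K ≤ x) :
    Real.exp (-x) ≤ (24 * Real.exp 1 + Real.exp K * (1 + K) ^ 4) * (1 + |x|) ^ (-4 : ℝ) := by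
  have h0 : 0 < 1 + |x| := by positivity
  rw [Real.rpow_neg h0.le, ← div_eq_mul_inv, le_div_iff₀ (Real.rpow_pos_of_pos h0 _),
    show (4 : ℝ) = ((4 : ℕ) : ℝ) by norm_num, Real.rpow_natCast]
  rcases le_total 0 x with h | h
  · rw [abs_of_nonneg h]
    have h4 := Real.pow_div_factorial_le_exp (1 + x) (by linarith) 4
    rw [div_le_iff₀ (by positivity), Real.exp_add] at h4
    have hf : ((Nat.factorial 4 : ℕ) : ℝ) = 24 := by norm_num [Nat.factorial]
    rw [hf] at h4
    calc Real.exp (-x) * (1 + x) ^ 4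
        ≤ Real.exp (-x) * (Real.exp 1 * Real.exp x * 24) := by gcongr
      _ = 24 * Real.exp 1 * (Real.exp (-x) * Real.exp x) := by ring
      _ = 24 * Real.exp 1 := by rw [← Real.exp_add]; simp
      _ ≤ _ := le_add_of_nonneg_right (by positivity)
  · rw [abs_of_nonpos h]
    calc Real.exp (-x) * (1 + -x) ^ 4 ≤ Real.exp K * (1 + K) ^ 4 := by
          gcongr <;> linarith
      _ ≤ _ := le_add_of_nonneg_left (by positivity)

theorem M_lt_top {K : ℝ} (hK : 0 ≤ K) (hbdd : ∀ u, InTree d u → -K ≤ position d u)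
    (hXi : Xi 4 d < ∞) : M d < ∞ := by
  set c := 24 * Real.exp 1 + Real.exp K * (1 + K) ^ 4 with hc
  have hc0 : 0 ≤ c := by positivity
  refine lt_of_le_of_lt (b := ENNReal.ofReal c * Xi 4 d) (iSup_le fun ξ => ?_)
    (ENNReal.mul_lt_top ENNReal.ofReal_lt_top hXi)
  refine le_trans ?_ (mul_le_mul_right (le_iSup _ ξ) _)
  rw [raySum, raySum, ← ENNReal.tsum_mul_left]
  refine ENNReal.tsum_le_tsum fun n => ?_
  split_ifs with hn
  · rw [← ENNReal.ofReal_mul hc0]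
    exact ENNReal.ofReal_le_ofReal (exp_neg_le hK (hbdd _ (ξ.mem_tree n hn)))
  · simp

end Rays

/-! ### Translating the hypotheses into Green bounds -/

section Hypotheses

variable {μ : Measure ℝ} {t : ℝ}

theorem isProbabilityMeasure_tilt (h : phi μ t = 0) : IsProbabilityMeasure (tilt t μ) := by
  constructor
  rw [tilt, withDensity_apply _ MeasurableSet.univ, Measure.restrict_univ]
  exact ENNReal.log_eq_one_iff.1 h

theorem posMoment_eq (μ : Measure ℝ) (t : ℝ) :
    posMoment μ t = ∫⁻ x, ENNReal.ofReal x ∂(tilt t μ) := by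
  rw [posMoment, lintegral_tilt _ _ (by fun_prop), ← lintegral_indicator measurableSet_Ioi]
  refine lintegral_congr fun x => ?_
  by_cases hx : 0 < x
  · rw [Set.indicator_of_mem (Set.mem_Ioi.2 hx), mul_comm, ENNReal.ofReal_mul (Real.exp_pos _).le]
  · rw [Set.indicator_of_notMem (by simpa using hx), ENNReal.ofReal_of_nonpos (not_lt.1 hx),
      mul_zero]

theorem negMoment_eq (μ : Measure ℝ) (t : ℝ) :
    negMoment μ t = ∫⁻ x, ENNReal.ofReal (-x) ∂(tilt t μ) := by
  rw [negMoment, lintegral_tilt _ _ (by fun_prop), ← lintegral_indicator measurableSet_Iio]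
  refine lintegral_congr fun x => ?_
  by_cases hx : x < 0
  · rw [Set.indicator_of_mem (Set.mem_Iio.2 hx), mul_comm, ENNReal.ofReal_mul (Real.exp_pos _).le,
      abs_of_neg hx]
  · rw [Set.indicator_of_notMem (by simpa using hx),
      ENNReal.ofReal_of_nonpos (neg_nonpos.2 (not_lt.1 hx)), mul_zero]

/-- Equal finite moments would give tilted mean 0; well-definedness excludes the remaining case ∞ -
∞. -/
theorem negMoment_ne_posMoment (hwd : TiltedMeanWellDefined μ t) (hne : tiltedMean μ t ≠ 0) :
    negMoment μ t ≠ posMoment μ t := by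
  intro h
  have hfin : posMoment μ t ≠ ∞ := by
    rcases hwd with h' | h'
    · exact (h ▸ h').ne
    · exact h'.ne
  refine hne ?_
  rw [tiltedMean, h]
  lift posMoment μ t to NNReal using hfin with a
  exact EReal.sub_self (by simp) (by simp)

theorem lintegral_sq_tilt (μ : Measure ℝ) (t : ℝ) :
    ∫⁻ x, ENNReal.ofReal (x ^ 2) ∂(tilt t μ)
      = ∫⁻ x, ENNReal.ofReal (x ^ 2 * Real.exp (-t * x)) ∂μ := by
  rw [lintegral_tilt _ _ (by fun_prop)]
  refine lintegral_congr fun x => ?_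
  rw [← ENNReal.ofReal_mul (Real.exp_pos _).le, mul_comm]

theorem H1.exists_greenBound (h : H1 μ) :
    ∃ t : ℝ, 0 < t ∧ IsProbabilityMeasure (tilt t μ) ∧ GreenBound (tilt t μ) 1 0 := by
  obtain ⟨t, ⟨⟨ht, hphi⟩, -⟩, hwd, hne⟩ := h
  have := isProbabilityMeasure_tilt hphi
  refine ⟨t, ht, this, greenBound_of_mean_ne_zero _ ?_⟩
  rw [← negMoment_eq, ← posMoment_eq]
  exact negMoment_ne_posMoment hwd hne

theorem H2.exists_greenBound (h : H2 μ) :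
    ∃ t : ℝ, 0 < t ∧ IsProbabilityMeasure (tilt t μ) ∧
      ∃ δ : ℝ, 0 < δ ∧ δ ≤ 1 ∧ GreenBound (tilt t μ) δ 1 := by
  obtain ⟨t, ht, hphi, -, -, hmean, hpos, hfin⟩ := h
  have := isProbabilityMeasure_tilt hphi
  rw [← lintegral_sq_tilt] at hpos hfin
  have hsq : Integrable (fun x => x ^ 2) (tilt t μ) := by
    refine ⟨by fun_prop, ?_⟩
    rw [hasFiniteIntegral_iff_ofReal (Filter.Eventually.of_forall fun x => sq_nonneg x)]
    exact hfin
  have hid : Integrable (fun x => x) (tilt t μ) := by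
    refine (hsq.add (integrable_const 1)).mono' (by fun_prop)
      (Filter.Eventually.of_forall fun x => ?_)
    rw [Real.norm_eq_abs, Pi.add_apply]
    nlinarith [sq_abs x, sq_nonneg (|x| - 1), abs_nonneg x]
  refine ⟨t, ht, this, greenBound_of_mean_zero _ hsq hid ?_ ?_⟩
  · rw [integral_eq_lintegral_pos_part_sub_lintegral_neg_part hid, ← posMoment_eq, ← negMoment_eq]
    have hp : posMoment μ t ≠ ∞ := by
      rw [posMoment_eq]
      exact (hid.lintegral_lt_top).ne
    have hn : negMoment μ t ≠ ∞ := by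
      rw [negMoment_eq]
      exact (hid.neg.lintegral_lt_top).ne
    rw [tiltedMean] at hmean
    lift posMoment μ t to NNReal using hp with a
    lift negMoment μ t to NNReal using hn with b
    rw [ENNReal.coe_toReal, ENNReal.coe_toReal]
    rw [EReal.coe_nnreal_eq_coe_real, EReal.coe_nnreal_eq_coe_real] at hmean
    exact_mod_cast hmean
  · rw [integral_eq_lintegral_of_nonneg_ae (Filter.Eventually.of_forall fun x => sq_nonneg x)
      hsq.aestronglyMeasurable]
    exact ENNReal.toReal_pos hpos.ne' hfin.ne

end Hypotheses

/-! ### Assembling the theorem -/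

section Conclusion

variable {Ω : Type*} [MeasurableSpace Ω] {P : Measure Ω} [IsProbabilityMeasure P]
  {D : Vertex → Ω → Offspring}

theorem ae_M_Xi_lt_top (hD : IsBranchingRandomWalk P D) {t : ℝ} (ht : 0 < t)
    [IsProbabilityMeasure (tilt t (intensity P D))] {δ : ℝ} (hδ : 0 < δ) (hδ1 : δ ≤ 1) {p : ℕ}
    (hp : p ≤ 1) (hgreen : GreenBound (tilt t (intensity P D)) δ p) :
    ∀ᵐ ω ∂P, M (fun u => D u ω) < ∞ ∧ ∀ b : ℝ, p + 2 < b → Xi b (fun u => D u ω) < ∞ := by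
  filter_upwards [ae_bddBelow hD ht,
    ae_all_iff.2 fun K : ℕ => ae_visits_le hD ht hδ hgreen K] with ω ⟨K, hK⟩ hvis
  obtain ⟨C, hC⟩ := hvis K hK
  have hXi : ∀ b : ℝ, p + 2 < b → Xi b (fun u => D u ω) < ∞ := fun b hb =>
    Xi_lt_top hδ hδ1 hC (by push_cast; linarith)
  have hp' : (p : ℝ) ≤ 1 := by exact_mod_cast hp
  exact ⟨M_lt_top K.cast_nonneg hK (hXi 4 (by linarith)), hXi⟩

end Conclusion

end BRW

end

theorem theorem1p1 {Ω : Type*} [MeasurableSpace Ω] (P : Measure Ω) [IsProbabilityMeasure P]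
    (D : BRW.Vertex → Ω → BRW.Offspring) (hD : BRW.IsBranchingRandomWalk P D)
    (hsuper : 1 < BRW.intensity P D Set.univ) :
    (BRW.H1 (BRW.intensity P D) ∨ BRW.H2 (BRW.intensity P D) →
      ∀ᵐ ω ∂(BRW.survivalMeasure P D), BRW.M (fun u => D u ω) < ∞) ∧
    (BRW.H1 (BRW.intensity P D) →
      ∀ᵐ ω ∂(BRW.survivalMeasure P D), ∀ b : ℝ, 2 < b → BRW.Xi b (fun u => D u ω) < ∞) ∧
    (BRW.H2 (BRW.intensity P D) →
      ∀ᵐ ω ∂(BRW.survivalMeasure P D), ∀ b : ℝ, 3 < b → BRW.Xi b (fun u => D u ω) < ∞) := by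
  -- Everything is proved almost surely under P, and conditioning preserves null sets. The threshold
  -- p + 2 is 2 for p = 0 and 3 for p = 1.
  have habs : BRW.survivalMeasure P D ≪ P := ProbabilityTheory.cond_absolutelyContinuous
  have h1 : BRW.H1 (BRW.intensity P D) → ∀ᵐ ω ∂(BRW.survivalMeasure P D),
      BRW.M (fun u => D u ω) < ∞ ∧ ∀ b : ℝ, 2 < b → BRW.Xi b (fun u => D u ω) < ∞ := by
    intro h
    obtain ⟨t, ht, _, hgreen⟩ := h.exists_greenBound
    filter_upwards [habs.ae_le (BRW.ae_M_Xi_lt_top hD ht one_pos le_rfl zero_le_one hgreen)]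
      with ω hω
    exact ⟨hω.1, fun b hb => hω.2 b (by norm_num; exact hb)⟩
  have h2 : BRW.H2 (BRW.intensity P D) → ∀ᵐ ω ∂(BRW.survivalMeasure P D),
      BRW.M (fun u => D u ω) < ∞ ∧ ∀ b : ℝ, 3 < b → BRW.Xi b (fun u => D u ω) < ∞ := by
    intro h
    obtain ⟨t, ht, _, δ, hδ, hδ1, hgreen⟩ := h.exists_greenBound
    filter_upwards [habs.ae_le (BRW.ae_M_Xi_lt_top hD ht hδ hδ1 le_rfl hgreen)] with ω hω
    exact ⟨hω.1, fun b hb => hω.2 b (by norm_num; exact hb)⟩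
  refine ⟨?_, fun h => (h1 h).mono fun _ hω => hω.2, fun h => (h2 h).mono fun _ hω => hω.2⟩
  rintro (h | h)
  · exact (h1 h).mono fun _ hω => hω.1
  · exact (h2 h).mono fun _ hω => hω.1
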